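/- Let $I$ be a finite set and let $\Delta$ be a (non-empty) building whose type is a right-angled Coxeter matrix $(m_{ij})_{i,j\in I}$, that is, $m_{ij}\in\{2,\infty\}$ for all $i\neq j$. For every $i\in I$ let $X_i$ be a set with $|X_i|\geq 2$, and suppose that $\Delta$ is semiregular with parameters $q_i=|X_i|$, i.e. every $i$-panel has cardinality $q_i$ (possibly infinite). View $\Delta$ as a chamber system, and let $\lambda=(\lambda_i)_{i\in I}\colon\Delta\to\prod_{i\in I}X_i$ be a legal colouring: for every $i$-panel $\mathcal P$, the restriction $\lambda_i|_{\mathcal P}\colon\mathcal P\to X_i$ is a bijection, and $\lambda_j|_{\mathcal P}$ is constant for every $j\neq i$. For every $i\in I$ let $F_i\leq\mathrm{Sym}(X_i)$ be an arbitrary permutation group. The universal group $U(\boldsymbol F)$ consists of all type-preserving automorphisms $g$ of $\Delta$ such that $\lambda_i|_{g\mathcal P}\circ g|_{\mathcal P}\circ(\lambda_i|_{\mathcal P})^{-1}\in F_i$ for every $i\in I$ and every $i$-panel $\mathcal P$. Let $J\subsetneq I$, and assume that if $I\setminus J$ consists of a single element $k$, then $k$ is not an isolated node of the Coxeter diagram,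 i.e. $m_{ik}=\infty$ for some $i\in I$. Theorem (primitivity). The group $U(\boldsymbol F)$ acts primitively on the set of $J$-residues of $\Delta$ if and only if the following three conditions hold: (i) $|I\setminus J|=1$, so that $I=J\sqcup\{k\}$ for some $k\in I$; (ii) $F_k$ is primitive and non-regular on $X_k$; (iii) $F_i$ is transitive on $X_i$ for every $i\in I$ with $m_{ik}=\infty$. Here an action is primitive if it is transitive and preserves no equivalence relation other than equality and the universal relation, and regular if it is transitive with trivial point stabilisers. -/

import Mathlib

open scoped Pointwise

/-- A Coxeter matrix is right-angled if `m i j ∈ {2, ∞}` for all `i ≠ j`.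
In Mathlib's convention the entry `∞` of a Coxeter matrix is encoded as `0`. -/
def CoxeterMatrix.IsRightAngled {I : Type*} (M : CoxeterMatrix I) : Prop :=
  ∀ i j, i ≠ j → M i j = 2 ∨ M i j = 0

/-- A permutation action is regular if it is transitive and all point stabilisers are trivial. -/
def IsRegularAction (G X : Type*) [Group G] [MulAction G X] : Prop :=
  MulAction.IsPretransitive G X ∧ ∀ x : X, MulAction.stabilizer G x = ⊥

/-- A chamber system over `I` with chamber set `C`: one equivalence relation for each `i : I`.
`Δ.equiv i c d` means that `c` and `d` are `i`-adjacent or equal. -/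
structure ChamberSystem (I C : Type*) where
  equiv : I → Setoid C

namespace ChamberSystem

variable {I C : Type*} (Δ : ChamberSystem I C)

/-- `Δ.IsGallery w c d`: there is a gallery of type `w` from `c` to `d`, that is, a sequence of
chambers in which consecutive chambers are distinct and `i`-adjacent, for the successive `i`
in the list `w`. -/
def IsGallery : List I → C → C → Prop
  | [], c, d => c = d
  | i :: w, c, d => ∃ e, c ≠ e ∧ Δ.equiv i c e ∧ IsGallery w e d

/-- The chambers that can be reached from `c` by a gallery whose type has all its entries
in `J`. -/
def residueOf (J : Set I) (c : C) : Set C :=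
  {d | ∃ w : List I, (∀ i ∈ w, i ∈ J) ∧ Δ.IsGallery w c d}

/-- The set of `J`-residues; each residue is identified with its set of chambers. -/
def Residue (J : Set I) : Type _ := {R : Set C // ∃ c, R = Δ.residueOf J c}

/-- A panel of type `i` is an `{i}`-residue. -/
abbrev Panel (i : I) : Type _ := Δ.Residue {i}

/-- `Δ` is a building of type `M`: it is non-empty, every panel contains at least two chambers,
and there is a Weyl distance `δ` with values in the Coxeter group of `M` such that, for every
reduced word `w`, there is a gallery of type `w` from `c` to `d` if and only if `δ c d` is the
element represented by `w`. -/
structure IsBuilding (M : CoxeterMatrix I) : Prop where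
  nonempty : Nonempty C
  two_le_panel : ∀ (i : I) (P : Δ.Panel i), P.1.Nontrivial
  exists_dist : ∃ δ : C → C → M.Group, ∀ w : List I, M.toCoxeterSystem.IsReduced w →
    ∀ c d, δ c d = M.toCoxeterSystem.wordProd w ↔ Δ.IsGallery w c d

/-- `Δ` is semiregular with parameters `q i = |X i| ≥ 2`: all `i`-panels have cardinality
`|X i|`. -/
def IsSemiregular (X : I → Type*) : Prop :=
  ∀ i, Nontrivial (X i) ∧ ∀ P : Δ.Panel i, Nonempty (P.1 ≃ X i)

/-- The group of type-preserving automorphisms. -/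
def Aut : Subgroup (Equiv.Perm C) where
  carrier := {g | ∀ i c d, Δ.equiv i (g c) (g d) ↔ Δ.equiv i c d}
  mul_mem' := by
    intro g h hg hh i c d
    exact (hg i (h c) (h d)).trans (hh i c d)
  one_mem' := fun _ _ _ => Iff.rfl
  inv_mem' := by
    intro g hg i c d
    have h := hg i (g⁻¹ c) (g⁻¹ d)
    simpa using h.symm

variable {Δ}

theorem isGallery_apply {g : Equiv.Perm C} (hg : g ∈ Δ.Aut) (w : List I) (c d : C) :
    Δ.IsGallery w (g c) (g d) ↔ Δ.IsGallery w c d := by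
  induction w generalizing c with
  | nil => exact g.injective.eq_iff
  | cons i w ih =>
    constructor
    · rintro ⟨e, hne, he, hw⟩
      obtain ⟨e, rfl⟩ := g.surjective e
      exact ⟨e, fun h => hne (congrArg g h), (hg i c e).1 he, (ih e).1 hw⟩
    · rintro ⟨e, hne, he, hw⟩
      exact ⟨g e, fun h => hne (g.injective h), (hg i c e).2 he, (ih e).2 hw⟩

theorem image_residueOf {g : Equiv.Perm C} (hg : g ∈ Δ.Aut) (J : Set I) (c : C) :
    g '' Δ.residueOf J c = Δ.residueOf J (g c) := by
  ext d
  constructor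
  · rintro ⟨e, ⟨w, hw, he⟩, rfl⟩
    exact ⟨w, hw, (isGallery_apply hg w c e).2 he⟩
  · rintro ⟨w, hw, hd⟩
    obtain ⟨e, rfl⟩ := g.surjective d
    exact ⟨e, ⟨w, hw, (isGallery_apply hg w c e).1 hd⟩, rfl⟩

/-- The automorphism group acts on the set of `J`-residues by `g • R = {g c | c ∈ R}`. -/
instance (J : Set I) : MulAction Δ.Aut (Δ.Residue J) where
  smul g R := ⟨g.1 '' R.1, by
    obtain ⟨c, hc⟩ := R.2
    exact ⟨g.1 c, by rw [hc, image_residueOf g.2]⟩⟩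
  one_smul R := Subtype.ext (Set.image_id R.1)
  mul_smul g h R := Subtype.ext (Set.image_comp g.1 h.1 R.1)

variable (Δ)

/-- A legal colouring `c ↦ (col c i)_i`: on every `i`-panel, the `i`-colour is a bijection
onto `X i`, and all other colours are constant. -/
structure LegalColouring (X : I → Type*) where
  col : C → ∀ i, X i
  bijective : ∀ (i : I) (P : Δ.Panel i), Function.Bijective (fun c : P.1 => col c i)
  constant : ∀ (i j : I), j ≠ i → ∀ P : Δ.Panel i, ∀ c ∈ P.1, ∀ d ∈ P.1, col c j = col d j

namespace LegalColouring

variable {Δ} {X : I → Type*} (L : Δ.LegalColouring X)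

/-- The bijection from an `i`-panel to the set of `i`-colours. -/
noncomputable def panelEquiv {i : I} (P : Δ.Panel i) : P.1 ≃ X i :=
  Equiv.ofBijective _ (L.bijective i P)

/-- The local action of the automorphism `g` at the `i`-panel `P`: apply the inverse of the
`i`-colouring of `P`, then `g : P → g • P`, then the `i`-colouring of `g • P`. -/
noncomputable def localAction (g : Δ.Aut) {i : I} (P : Δ.Panel i) : Equiv.Perm (X i) :=
  (L.panelEquiv P).symm.trans ((Equiv.image g.1 P.1).trans (L.panelEquiv (g • P)))

theorem localAction_col (g : Δ.Aut) {i : I} (P : Δ.Panel i) (c : C) (hc : c ∈ P.1) :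
    L.localAction g P (L.col c i) = L.col (g.1 c) i := by
  have h : (L.panelEquiv P).symm (L.col c i) = ⟨c, hc⟩ := by
    rw [Equiv.symm_apply_eq]
    rfl
  simp only [localAction, Equiv.trans_apply, h]
  rfl

theorem localAction_one {i : I} (P : Δ.Panel i) : L.localAction 1 P = 1 := by
  ext x
  obtain ⟨c, rfl⟩ := (L.panelEquiv P).surjective x
  exact L.localAction_col 1 P c.1 c.2

theorem localAction_mul (g h : Δ.Aut) {i : I} (P : Δ.Panel i) :
    L.localAction (g * h) P = L.localAction g (h • P) * L.localAction h P := by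
  ext x
  obtain ⟨c, rfl⟩ := (L.panelEquiv P).surjective x
  have e1 := L.localAction_col (g * h) P c.1 c.2
  have e2 := L.localAction_col h P c.1 c.2
  have e3 := L.localAction_col g (h • P) (h.1 c.1) ⟨c.1, c.2, rfl⟩
  rw [Equiv.Perm.mul_apply]
  exact e1.trans ((congrArg _ e2).trans e3).symm

/-- The universal group with local groups `F i`: all automorphisms whose local action at every
`i`-panel lies in `F i`, for every `i`. -/
def universalGroup (F : ∀ i, Subgroup (Equiv.Perm (X i))) : Subgroup Δ.Aut where
  carrier := {g | ∀ (i : I) (P : Δ.Panel i), L.localAction g P ∈ F i}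
  mul_mem' := by
    intro g h hg hh i P
    rw [localAction_mul]
    exact mul_mem (hg i _) (hh i P)
  one_mem' := by
    intro i P
    rw [localAction_one]
    exact one_mem _
  inv_mem' := by
    intro g hg i P
    have h := L.localAction_mul g g⁻¹ P
    rw [mul_inv_cancel, localAction_one] at h
    rw [eq_inv_of_mul_eq_one_right h.symm]
    exact inv_mem (hg i _)

end LegalColouring

end ChamberSystem

/-!
A legal colouring turns the chamber `c` and a colour `x : X i` into the chamber `L.move i x c` of
colour `x` in the `i`-panel of `c`. Moves of commuting types commute, and in a right-angled
building these are the only relations: the word problem of a right-angled Coxeter group is solved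
by commutations and cancellations (a word without cancellations is reduced, as its action on the
numbers game shows). So the building is the universal set with colours and moves, which makes it
homogeneous: every legal recolouring of the building comes from an automorphism.

The same universality yields the wings of a `k`-panel. The projection to the panel of `b`, read as
a function `π` with values in `X k`, changes only under `k`-moves inside the tree-wall of `b`; so
it is constant on `{k}ᶜ`-residues, and if `f ∈ F k` fixes `x`, then recolouring outside the wing
`π = x` by `f` gives an element of the universal group that fixes this wing.

If the action on `J`-residues is primitive, then `J = {k}ᶜ`, since the `{l}ᶜ`-residues for `l ∉ J`
form an invariant coarsening. A relation on `X k`, the orbits in `X i` for `m i k = ∞`, and, when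
`F k` is regular, the `k`-colour itself all define invariant relations on chambers, and a wing
function shows that they are proper unless the respective condition holds.

Conversely, an invariant relation that joins two residues joins residues separated by a wing of
some panel. An element of `F k` that fixes the colour of this wing and moves another one gives two
related chambers in one `k`-panel; primitivity of `F k` relates the whole panel, and transitivity
of the `F i` carries this to all `k`-panels.
-/

namespace RightAngledCoxeter

variable {I : Type*} {M : CoxeterMatrix I}

variable (M) in
/-- The letter `i` can be brought to the front of the word by commutations. -/
def CanStart (i : I) : List I → Prop
  | [] => False
  | j :: u => j = i ∨ (M i j = 2 ∧ CanStart i u)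

variable (M) in
/-- No two letters of the word cancel after commutations. For right-angled `M` these are the
reduced words, by `commReduced_of_isReduced` and `CommReduced.isReduced`. -/
def CommReduced : List I → Prop
  | [] => True
  | i :: u => ¬ CanStart M i u ∧ CommReduced u

theorem CanStart.exists_split {i : I} {u : List I} (h : CanStart M i u) :
    ∃ v t, u = v ++ i :: t ∧ ∀ j ∈ v, M i j = 2 := by
  induction u with
  | nil => exact h.elim
  | cons j u ih =>
    rcases h with rfl | ⟨hj, h⟩
    · exact ⟨[], u, rfl, by simp⟩
    · obtain ⟨v, t, rfl, hv⟩ := ih h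
      exact ⟨j :: v, t, rfl, by simpa [hj] using hv⟩

theorem exists_split_of_not_commReduced {u : List I} (h : ¬ CommReduced M u) :
    ∃ a i v t, u = a ++ i :: (v ++ i :: t) ∧ ∀ j ∈ v, M i j = 2 := by
  induction u with
  | nil => exact (h trivial).elim
  | cons j u ih =>
    by_cases hj : CanStart M j u
    · obtain ⟨v, t, rfl, hv⟩ := hj.exists_split
      exact ⟨[], j, v, t, rfl, hv⟩
    · obtain ⟨a, i, v, t, rfl, hv⟩ := ih fun hu => h ⟨hj, hu⟩
      exact ⟨j :: a, i, v, t, rfl, hv⟩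

theorem commute_simple {i j : I} (h : M i j = 2) :
    Commute (M.toCoxeterSystem.simple i) (M.toCoxeterSystem.simple j) := by
  have hsq := M.toCoxeterSystem.simple_mul_simple_pow i j
  rw [h, pow_two] at hsq
  rw [Commute, SemiconjBy, eq_inv_of_mul_eq_one_left hsq, mul_inv_rev,
    M.toCoxeterSystem.inv_simple, M.toCoxeterSystem.inv_simple]

theorem commute_simple_wordProd {i : I} {v : List I} (hv : ∀ j ∈ v, M i j = 2) :
    Commute (M.toCoxeterSystem.simple i) (M.toCoxeterSystem.wordProd v) :=
  Commute.list_prod_right _ _ fun _ hx => by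
    obtain ⟨j, hj, rfl⟩ := List.mem_map.1 hx
    exact commute_simple (hv j hj)

theorem commReduced_of_isReduced {u : List I} (h : M.toCoxeterSystem.IsReduced u) :
    CommReduced M u := by
  by_contra hu
  obtain ⟨a, i, v, t, rfl, hv⟩ := exists_split_of_not_commReduced hu
  have hprod : M.toCoxeterSystem.wordProd (a ++ i :: (v ++ i :: t)) =
      M.toCoxeterSystem.wordProd (a ++ (v ++ t)) := by
    simp only [CoxeterSystem.wordProd_append, CoxeterSystem.wordProd_cons]
    rw [(commute_simple_wordProd hv).left_comm, M.toCoxeterSystem.simple_mul_simple_cancel_left]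
  have hle := M.toCoxeterSystem.length_wordProd_le (a ++ (v ++ t))
  rw [← hprod, h.eq] at hle
  simp at hle

/-- The number `2 cos (π / m)` for `m = ∞` (encoded as `0`), `m = 1` and `m = 2`; the value at
`m > 2` is irrelevant. -/
def fireCoeff : ℕ → ℤ
  | 0 => 2
  | 1 => -2
  | _ => 0

variable (M) in
/-- Firing the node `i` in Mozes' numbers game. This is the action of the simple reflection `i`
in the dual of the geometric representation when `M` is right-angled. -/
def fire (i : I) (p : I → ℤ) : I → ℤ :=
  fun j => p j + fireCoeff (M i j) * p i

theorem fire_self (i : I) (p : I → ℤ) : fire M i p i = -p i := by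
  simp only [fire, M.diagonal, fireCoeff]
  ring

theorem fire_of_eq_two {i j : I} (h : M i j = 2) (p : I → ℤ) : fire M i p j = p j := by
  simp [fire, h, fireCoeff]

theorem fire_of_eq_zero {i j : I} (h : M i j = 0) (p : I → ℤ) :
    fire M i p j = p j + 2 * p i := by
  simp [fire, h, fireCoeff]

theorem fire_fire (i : I) (p : I → ℤ) : fire M i (fire M i p) = p := by
  funext j
  rw [fire, fire_self, fire]
  ring

theorem fire_comm {i j : I} (h : M i j = 2) (p : I → ℤ) :
    fire M i (fire M j p) = fire M j (fire M i p) := by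
  funext l
  rw [fire, fire_of_eq_two ((M.symmetric j i).trans h), fire, fire, fire_of_eq_two h, fire]
  ring

variable (M) in
/-- Firing a node, as a permutation of the positions of the numbers game. -/
def firePerm (i : I) : Equiv.Perm (I → ℤ) :=
  ⟨fire M i, fire M i, fire_fire i, fire_fire i⟩

theorem isLiftable_firePerm (hM : M.IsRightAngled) : M.IsLiftable (firePerm M) := by
  intro i j
  ext1 p
  by_cases hij : i = j
  · subst hij
    simpa [firePerm] using fire_fire i p
  · rcases hM i j hij with h | h
    · simp [h, pow_two, firePerm, fire_comm h, fire_fire]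
    · simp [h]

/-- The position reached from the constant position `1` of the numbers game by letting the
Coxeter group act. -/
def position (hM : M.IsRightAngled) (w : M.Group) : I → ℤ :=
  M.toCoxeterSystem.lift ⟨_, isLiftable_firePerm hM⟩ w fun _ => 1

theorem position_wordProd_nil (hM : M.IsRightAngled) :
    position hM (M.toCoxeterSystem.wordProd []) = fun _ => 1 := by
  simp [position]

theorem position_wordProd_cons (hM : M.IsRightAngled) (i : I) (u : List I) :
    position hM (M.toCoxeterSystem.wordProd (i :: u)) =
      fire M i (position hM (M.toCoxeterSystem.wordProd u)) := by
  rw [position, CoxeterSystem.wordProd_cons, map_mul, CoxeterSystem.lift_apply_simple]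
  rfl

/-- The signs that the word `u` forces on the position `p` it leads to. The last condition is what
makes the induction on `u` work. -/
structure HasSigns (M : CoxeterMatrix I) (u : List I) (p : I → ℤ) : Prop where
  neg : ∀ i, CanStart M i u → p i < 0
  pos : ∀ i, ¬ CanStart M i u → 0 < p i
  add_pos : ∀ i j, M i j = 0 → 0 < p i + p j

theorem HasSigns.fire (hM : M.IsRightAngled) {u : List I} {p : I → ℤ} (h : HasSigns M u p)
    {l : I} (hl : ¬ CanStart M l u) : HasSigns M (l :: u) (fire M l p) := by
  have hpl := h.pos l hl
  refine ⟨?neg, ?pos, ?add_pos⟩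
  case neg =>
    rintro i (rfl | ⟨hil, hi⟩)
    · rw [fire_self]
      omega
    · rw [fire_of_eq_two ((M.symmetric l i).trans hil)]
      exact h.neg i hi
  case pos =>
    intro i hi
    obtain ⟨hli, hi⟩ := not_or.1 hi
    rcases hM l i hli with hli | hli
    · rw [fire_of_eq_two hli]
      exact h.pos i fun hi' => hi ⟨(M.symmetric i l).trans hli, hi'⟩
    · rw [fire_of_eq_zero hli]
      have := h.add_pos l i hli
      omega
  case add_pos =>
    have hfire_ge : ∀ i, i ≠ l → p i ≤ RightAngledCoxeter.fire M l p i := fun i hi => by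
      rcases hM l i hi.symm with hli | hli
      · rw [fire_of_eq_two hli]
      · rw [fire_of_eq_zero hli]
        omega
    intro i j hij
    have hp := h.add_pos i j hij
    by_cases hi : i = l
    · subst hi
      rw [fire_self, fire_of_eq_zero hij]
      omega
    by_cases hj : j = l
    · subst hj
      rw [fire_self, fire_of_eq_zero ((M.symmetric j i).trans hij)]
      omega
    have := hfire_ge i hi
    have := hfire_ge j hj
    omega

theorem CommReduced.hasSigns_position (hM : M.IsRightAngled) {u : List I} (hu : CommReduced M u) :
    HasSigns M u (position hM (M.toCoxeterSystem.wordProd u)) := by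
  induction u with
  | nil =>
    rw [position_wordProd_nil]
    exact ⟨fun _ h => h.elim, fun _ _ => one_pos, fun _ _ _ => by norm_num⟩
  | cons l u ih =>
    rw [position_wordProd_cons]
    exact (ih hu.2).fire hM hu.1

theorem CommReduced.canStart_iff (hM : M.IsRightAngled) {u : List I} (hu : CommReduced M u)
    (i : I) : CanStart M i u ↔ position hM (M.toCoxeterSystem.wordProd u) i < 0 :=
  ⟨(hu.hasSigns_position hM).neg i,
    fun h => by_contra fun hi => h.not_gt ((hu.hasSigns_position hM).pos i hi)⟩

theorem CommReduced.isReduced (hM : M.IsRightAngled) {u : List I} (hu : CommReduced M u) :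
    M.toCoxeterSystem.IsReduced u := by
  induction u with
  | nil => simp [CoxeterSystem.IsReduced]
  | cons i u ih =>
    have hred := ih hu.2
    by_contra hnot
    have hdesc : M.toCoxeterSystem.IsLeftDescent (M.toCoxeterSystem.wordProd u) i := by
      by_contra hdesc
      rw [M.toCoxeterSystem.not_isLeftDescent_iff, ← CoxeterSystem.wordProd_cons, hred.eq] at hdesc
      exact hnot (hdesc.trans (List.length_cons ..).symm)
    -- A reduced word of `sᵢ * πᵤ` gives a reduced word `i :: v` of `πᵤ`; so `i` can start `u` too.
    obtain ⟨v, hv, hsv⟩ := M.toCoxeterSystem.exists_isReduced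
      (M.toCoxeterSystem.simple i * M.toCoxeterSystem.wordProd u)
    have hprod : M.toCoxeterSystem.wordProd (i :: v) = M.toCoxeterSystem.wordProd u := by
      rw [CoxeterSystem.wordProd_cons, ← hsv, M.toCoxeterSystem.simple_mul_simple_cancel_left]
    have hiv : M.toCoxeterSystem.IsReduced (i :: v) := by
      rw [M.toCoxeterSystem.isLeftDescent_iff, hsv, hv.eq] at hdesc
      rw [CoxeterSystem.IsReduced, hprod, ← hdesc, List.length_cons]
    have hcan := ((commReduced_of_isReduced hiv).canStart_iff hM i).1 (Or.inl rfl)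
    rw [hprod] at hcan
    exact hu.1 ((hu.2.canStart_iff hM i).2 hcan)

end RightAngledCoxeter

section Primitive

open MulAction

variable {G C Y : Type*} [Group G] [MulAction G Y]

theorem isBlock_setOf_rel {E : Setoid Y} (hE : ∀ g : G, E ≤ E.comap (g • ·)) (y : Y) :
    IsBlock G {x | E x y} := by
  rw [isBlock_iff_smul_eq_of_mem]
  intro g x hx hgx
  have hgy : E (g • y) y := E.trans' (E.symm' (hE g hx)) hgx
  ext z
  rw [Set.mem_smul_set_iff_inv_smul_mem]
  refine ⟨fun hz => ?_, fun hz => ?_⟩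
  · simpa only [Set.mem_ofPred_eq, Setoid.comap_rel, smul_inv_smul] using E.trans' (hE g hz) hgy
  · simpa only [Set.mem_ofPred_eq, Setoid.comap_rel, inv_smul_smul] using
      hE g⁻¹ (E.trans' hz (E.symm' hgy))

theorem isTrivialBlock_of_forall_setoid
    (h : ∀ E : Setoid Y, (∀ g : G, E ≤ E.comap (g • ·)) → E = ⊥ ∨ E = ⊤)
    {B : Set Y} (hB : IsBlock G B) : IsTrivialBlock B := by
  let E : Setoid Y := Setoid.ker fun x => {g : G | x ∈ g • B}
  have hE : ∀ g : G, E ≤ E.comap (g • ·) := fun g x y hxy => by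
    have hiff : ∀ g' : G, x ∈ g' • B ↔ y ∈ g' • B := Set.ext_iff.1 (Setoid.ker_def.1 hxy)
    exact Set.ext fun g' => by
      simpa only [Set.mem_ofPred_eq, mul_smul, Set.mem_inv_smul_set_iff] using hiff (g⁻¹ * g')
  have hmem : ∀ {x g}, x ∈ B → (x ∈ g • B ↔ g • B = B) := fun {x g} hx =>
    ⟨fun hgx => (hB.smul_eq_or_disjoint g).resolve_right fun hd =>
      Set.disjoint_left.1 hd hgx hx, fun hg => hg.symm ▸ hx⟩
  rcases h E hE with hbot | htop
  · refine Or.inl fun x hx y hy => ?_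
    have hxy : E x y := Set.ext fun g => (hmem hx).trans (hmem hy).symm
    rwa [hbot] at hxy
  · rcases B.eq_empty_or_nonempty with rfl | ⟨x, hx⟩
    · exact Or.inl Set.subsingleton_empty
    · refine Or.inr (Set.eq_univ_of_forall fun y => ?_)
      have hxy : E x y := htop ▸ trivial
      simpa only [Set.mem_ofPred_eq, one_smul, hx, true_iff] using
        Set.ext_iff.1 (Setoid.ker_def.1 hxy) 1

theorem isPreprimitive_iff_forall_setoid : IsPreprimitive G Y ↔ IsPretransitive G Y ∧
    ∀ E : Setoid Y, (∀ g : G, E ≤ E.comap (g • ·)) → E = ⊥ ∨ E = ⊤ := by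
  refine ⟨fun h => ⟨h.toIsPretransitive, fun E hE => ?_⟩, fun ⟨htrans, h⟩ =>
    { htrans with isTrivialBlock_of_isBlock := isTrivialBlock_of_forall_setoid h }⟩
  by_cases huniv : ∃ y, {x | E x y} = Set.univ
  · obtain ⟨y, hy⟩ := huniv
    have hrel : ∀ x, E x y := Set.eq_univ_iff_forall.1 hy
    exact Or.inr (eq_top_iff.2 fun x z _ => E.trans' (hrel x) (E.symm' (hrel z)))
  · refine Or.inl (eq_bot_iff.2 fun x y hxy => ?_)
    have htriv := h.isTrivialBlock_of_isBlock (isBlock_setOf_rel hE y)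
    exact htriv.resolve_right (fun hy => huniv ⟨y, hy⟩) hxy (E.refl' y)

theorem isPreprimitive_iff_forall_setoid_of_surjective [SMul G C] {p : C → Y}
    (hp : Function.Surjective p) (hsmul : ∀ (g : G) c, p (g • c) = g • p c) :
    IsPreprimitive G Y ↔ IsPretransitive G Y ∧
      ∀ E : Setoid C, Setoid.ker p ≤ E → (∀ g : G, E ≤ E.comap (g • ·)) →
        E = Setoid.ker p ∨ E = ⊤ := by
  have hcomap : ∀ (E : Setoid Y) (g : G),
      E ≤ E.comap (g • ·) ↔ E.comap p ≤ (E.comap p).comap (g • ·) := by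
    refine fun E g => ⟨fun h c d hcd => ?_, fun h x y hxy => ?_⟩
    · simpa only [Setoid.comap_rel, hsmul] using h hcd
    · obtain ⟨c, rfl⟩ := hp x
      obtain ⟨d, rfl⟩ := hp y
      simpa only [Setoid.comap_rel, hsmul] using h hxy
  have hinj := Setoid.comap_injective p hp
  have htop : (⊤ : Setoid Y).comap p = ⊤ := rfl
  have hbot : (⊥ : Setoid Y).comap p = Setoid.ker p := rfl
  rw [isPreprimitive_iff_forall_setoid]
  refine and_congr_right fun _ => ⟨fun h E hle hE => ?_, fun h E hE => ?_⟩
  · obtain ⟨E, rfl⟩ : ∃ E', Setoid.comap p E' = E := ⟨_, Setoid.comap_map_of_ker_le p E hle⟩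
    rw [← htop, ← hbot, hinj.eq_iff, hinj.eq_iff]
    exact h E fun g => (hcomap E g).2 (hE g)
  · rw [← hinj.eq_iff, ← hinj.eq_iff (b := ⊤), htop, hbot]
    refine h _ (fun c d hcd => ?_) fun g => (hcomap E g).1 (hE g)
    rw [Setoid.comap_rel, Setoid.ker_def.1 hcd]

theorem exists_smul_eq_and_smul_ne [FaithfulSMul G Y] (hp : IsPreprimitive G Y)
    (hr : ¬ IsRegularAction G Y) {x y : Y} (hxy : x ≠ y) : ∃ g : G, g • x = x ∧ g • y ≠ y := by
  by_contra! hfix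
  have : Nontrivial Y := ⟨x, y, hxy⟩
  have hcoatom : ∀ z : Y, IsCoatom (stabilizer G z) := fun z =>
    (isCoatom_stabilizer_iff_preprimitive G z).2 hp
  have hstab : stabilizer G x = stabilizer G y :=
    ((hcoatom x).le_iff_eq (hcoatom y).1).1 (fun g => hfix g) |>.symm
  let E : Setoid Y := Setoid.ker (stabilizer G)
  have hE : ∀ g : G, E ≤ E.comap (g • ·) := fun g a b hab => by
    have hab : stabilizer G a = stabilizer G b := hab
    simp only [E, Setoid.comap_rel, Setoid.ker_def, stabilizer_smul_eq_stabilizer_map_conj, hab]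
  rcases (isPreprimitive_iff_forall_setoid.1 hp).2 E hE with hbot | htop
  · exact hxy (Setoid.ker_eq_bot_iff.1 hbot hstab)
  · refine hr ⟨hp.toIsPretransitive, fun a => (Subgroup.eq_bot_iff_forall _).2 fun g hg => ?_⟩
    refine eq_of_smul_eq_smul fun b : Y => ?_
    have hab : E a b := htop ▸ trivial
    rw [one_smul, ← mem_stabilizer_iff, ← Setoid.ker_def.1 hab]
    exact hg

end Primitive

namespace ChamberSystem

variable {I C : Type*}

section Residues

variable (Δ : ChamberSystem I C) {J : Set I}

/-- The equivalence relation whose classes are the `J`-residues. -/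
def residueSetoid (J : Set I) : Setoid C := ⨆ i ∈ J, Δ.equiv i

variable {Δ}

theorem residueSetoid_le_iff {E : Setoid C} :
    Δ.residueSetoid J ≤ E ↔ ∀ i ∈ J, Δ.equiv i ≤ E := by
  rw [residueSetoid, iSup₂_le_iff]

theorem equiv_le_residueSetoid {i : I} (hi : i ∈ J) : Δ.equiv i ≤ Δ.residueSetoid J :=
  residueSetoid_le_iff.1 le_rfl i hi

theorem residueSetoid_singleton (i : I) : Δ.residueSetoid {i} = Δ.equiv i :=
  iSup_singleton

theorem residueOf_subset_of_equiv {i : I} (hi : i ∈ J) {c d : C} (h : Δ.equiv i c d) :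
    Δ.residueOf J d ⊆ Δ.residueOf J c := by
  by_cases hcd : c = d
  · rw [hcd]
  · rintro e ⟨w, hw, he⟩
    exact ⟨i :: w, by simpa [hi] using hw, d, hcd, h, he⟩

theorem residueSetoid_of_isGallery {w : List I} (hw : ∀ i ∈ w, i ∈ J) {c d : C}
    (h : Δ.IsGallery w c d) : Δ.residueSetoid J c d := by
  induction w generalizing c with
  | nil => exact h ▸ Setoid.refl' _ c
  | cons i w ih =>
    obtain ⟨e, -, hce, hed⟩ := h
    rw [List.forall_mem_cons] at hw
    exact Setoid.trans' _ (equiv_le_residueSetoid hw.1 hce) (ih hw.2 hed)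

theorem mem_residueOf_iff {c d : C} : d ∈ Δ.residueOf J c ↔ Δ.residueSetoid J c d := by
  refine ⟨fun ⟨w, hw, h⟩ => residueSetoid_of_isGallery hw h, fun h => ?_⟩
  have hle : Δ.residueSetoid J ≤ Setoid.ker (Δ.residueOf J) :=
    residueSetoid_le_iff.2 fun i hi c d h => (residueOf_subset_of_equiv hi
      (Setoid.symm' _ h)).antisymm (residueOf_subset_of_equiv hi h)
  exact (hle h).symm ▸ ⟨[], by simp, rfl⟩

variable (Δ) in
/-- The `J`-residue of a chamber, as a point of the set of `J`-residues. -/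
def residueAt (J : Set I) (c : C) : Δ.Residue J := ⟨Δ.residueOf J c, c, rfl⟩

theorem residueAt_surjective : Function.Surjective (Δ.residueAt J) := by
  rintro ⟨_, c, rfl⟩
  exact ⟨c, rfl⟩

theorem ker_residueAt : Setoid.ker (Δ.residueAt J) = Δ.residueSetoid J := by
  ext c d
  rw [Setoid.ker_def, ← mem_residueOf_iff]
  constructor
  · intro h
    rw [show Δ.residueOf J c = Δ.residueOf J d from congrArg Subtype.val h]
    exact mem_residueOf_iff.2 (Setoid.refl' _ d)
  · intro h
    refine Subtype.ext (Set.ext fun e => ?_)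
    have h' := mem_residueOf_iff.1 h
    simp only [residueAt, mem_residueOf_iff]
    exact ⟨Setoid.trans' _ (Setoid.symm' _ h'), Setoid.trans' _ h'⟩

theorem smul_residueAt (g : Δ.Aut) (c : C) : g • Δ.residueAt J c = Δ.residueAt J (g • c) :=
  Subtype.ext (image_residueOf g.2 J c)

theorem mem_panel_residueAt {i : I} {c d : C} :
    d ∈ (Δ.residueAt {i} c).1 ↔ Δ.equiv i c d := by
  rw [← residueSetoid_singleton]
  exact mem_residueOf_iff

theorem residueSetoid_smul (g : Δ.Aut) {c d : C} (h : Δ.residueSetoid J c d) :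
    Δ.residueSetoid J (g • c) (g • d) := by
  have hle : Δ.residueSetoid J ≤ (Δ.residueSetoid J).comap (g • ·) :=
    residueSetoid_le_iff.2 fun i hi c d h => equiv_le_residueSetoid hi ((g.2 i c d).2 h)
  exact hle h

theorem IsBuilding.residueSetoid_univ {M : CoxeterMatrix I} (hΔ : Δ.IsBuilding M) :
    Δ.residueSetoid Set.univ = ⊤ := by
  obtain ⟨δ, hδ⟩ := hΔ.exists_dist
  refine eq_top_iff.2 fun c d _ => ?_
  obtain ⟨w, hw, h⟩ := M.toCoxeterSystem.exists_isReduced (δ c d)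
  exact residueSetoid_of_isGallery (fun _ _ => Set.mem_univ _) ((hδ w hw c d).1 h)

end Residues

namespace LegalColouring

variable {Δ : ChamberSystem I C} {X : I → Type*} (L : Δ.LegalColouring X)

/-- The chamber with `i`-colour `x` in the `i`-panel of `c`. -/
noncomputable def move (i : I) (x : X i) (c : C) : C :=
  ((L.panelEquiv (Δ.residueAt {i} c)).symm x).1

theorem equiv_move (i : I) (x : X i) (c : C) : Δ.equiv i c (L.move i x c) :=
  mem_panel_residueAt.1 ((L.panelEquiv (Δ.residueAt {i} c)).symm x).2

@[simp]
theorem col_move_self (i : I) (x : X i) (c : C) : L.col (L.move i x c) i = x :=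
  (L.panelEquiv (Δ.residueAt {i} c)).apply_symm_apply x

theorem col_eq_of_equiv {i j : I} (hj : j ≠ i) {c d : C} (h : Δ.equiv i c d) :
    L.col c j = L.col d j :=
  L.constant i j hj (Δ.residueAt {i} c) c (mem_panel_residueAt.2 (Setoid.refl' _ c)) d
    (mem_panel_residueAt.2 h)

theorem col_move_of_ne {i j : I} (hj : j ≠ i) (x : X i) (c : C) :
    L.col (L.move i x c) j = L.col c j :=
  (L.col_eq_of_equiv hj (L.equiv_move i x c)).symm

theorem eq_of_equiv_of_col_eq {i : I} {c d : C} (h : Δ.equiv i c d)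
    (hcol : L.col c i = L.col d i) : c = d :=
  congrArg Subtype.val ((L.bijective i (Δ.residueAt {i} c)).1
    (a₁ := ⟨c, mem_panel_residueAt.2 (Setoid.refl' _ c)⟩) (a₂ := ⟨d, mem_panel_residueAt.2 h⟩)
    hcol)

theorem move_eq_of_equiv {i : I} {c d : C} (h : Δ.equiv i c d) : L.move i (L.col d i) c = d :=
  L.eq_of_equiv_of_col_eq (Setoid.trans' _ (Setoid.symm' _ (L.equiv_move i _ c)) h) (by simp)

theorem move_col (i : I) (c : C) : L.move i (L.col c i) c = c :=
  L.move_eq_of_equiv (Setoid.refl' _ c)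

@[simp]
theorem move_move (i : I) (x y : X i) (c : C) : L.move i x (L.move i y c) = L.move i x c :=
  L.eq_of_equiv_of_col_eq
    (Setoid.trans' _ (Setoid.symm' _ (L.equiv_move i x _))
      (Setoid.trans' _ (Setoid.symm' _ (L.equiv_move i y c)) (L.equiv_move i x c))) (by simp)

theorem equiv_le_iff {i : I} {E : Setoid C} : Δ.equiv i ≤ E ↔ ∀ x c, E c (L.move i x c) :=
  ⟨fun h x c => h (L.equiv_move i x c), fun h c _ hcd => L.move_eq_of_equiv hcd ▸ h _ c⟩

theorem residueSetoid_move {J : Set I} {i : I} (hi : i ∈ J) (x : X i) (c : C) :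
    Δ.residueSetoid J c (L.move i x c) :=
  equiv_le_residueSetoid hi (L.equiv_move i x c)

theorem residueSetoid_le_iff {J : Set I} {E : Setoid C} :
    Δ.residueSetoid J ≤ E ↔ ∀ i ∈ J, ∀ x c, E c (L.move i x c) := by
  simp only [ChamberSystem.residueSetoid_le_iff, L.equiv_le_iff]

theorem col_eq_of_residueSetoid {J : Set I} {i : I} (hi : i ∉ J) {c d : C}
    (h : Δ.residueSetoid J c d) : L.col c i = L.col d i := by
  have hle : Δ.residueSetoid J ≤ Setoid.ker (L.col · i) :=
    L.residueSetoid_le_iff.2 fun j hj x c =>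
      (L.col_move_of_ne (ne_of_mem_of_not_mem hj hi).symm x c).symm
  exact hle h

theorem residueSetoid_induction {J : Set I} {b : C} {p : C → Prop} (base : p b)
    (step : ∀ i ∈ J, ∀ x c, Δ.residueSetoid J b c → p c → p (L.move i x c)) {c : C}
    (h : Δ.residueSetoid J b c) : p c := by
  let q : C → Prop := fun c => Δ.residueSetoid J b c ∧ p c
  have hstep : ∀ i ∈ J, ∀ x c, q c → q (L.move i x c) := fun i hi x c hc =>
    ⟨Setoid.trans' _ hc.1 (L.residueSetoid_move hi x c), step i hi x c hc.1 hc.2⟩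
  have hle : Δ.residueSetoid J ≤ Setoid.ker q :=
    L.residueSetoid_le_iff.2 fun i hi x c => propext ⟨hstep i hi x c, fun hc => by
      simpa only [move_move, move_col] using hstep i hi (L.col c i) _ hc⟩
  exact ((hle h : q b = q c) ▸ (⟨Setoid.refl' _ b, base⟩ : q b) : q c).2

theorem induction_move {M : CoxeterMatrix I} (hΔ : Δ.IsBuilding M) {p : C → Prop} (b : C)
    (base : p b) (step : ∀ i x c, p c → p (L.move i x c)) (c : C) : p c :=
  L.residueSetoid_induction (J := Set.univ) base (fun i _ x c _ => step i x c)
    (hΔ.residueSetoid_univ ▸ trivial)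

end LegalColouring

variable {M : CoxeterMatrix I} {X : I → Type*} {Y Z : Type*}

/-- A set with colours and moves that obey the rules of the moves between the chambers of a
right-angled building, see `LegalColouring.moveSystem`. By `LegalColouring.exists_map_move`
buildings are the universal move systems. -/
structure MoveSystem (M : CoxeterMatrix I) (X : I → Type*) (Y : Type*) where
  col : Y → ∀ i, X i
  move : ∀ i, X i → Y → Y
  move_col : ∀ i y, move i (col y i) y = y
  col_move_self : ∀ i x y, col (move i x y) i = x
  col_move_of_ne : ∀ {i j}, j ≠ i → ∀ x y, col (move i x y) j = col y j
  move_move : ∀ i x x' y, move i x (move i x' y) = move i x y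
  move_comm : ∀ {i j}, M i j = 2 → ∀ x x' y, move i x (move j x' y) = move j x' (move i x y)

namespace MoveSystem

variable (S : MoveSystem M X Y) (T : MoveSystem M X Z)

/-- Carry out a sequence of moves, the head of the list first. -/
def run (w : List (Σ i, X i)) (y : Y) : Y :=
  w.foldl (fun y a => S.move a.1 a.2 y) y

@[simp]
theorem run_nil (y : Y) : S.run [] y = y := rfl

@[simp]
theorem run_cons (a : Σ i, X i) (w : List (Σ i, X i)) (y : Y) :
    S.run (a :: w) y = S.run w (S.move a.1 a.2 y) := rfl

@[simp]
theorem run_append (v w : List (Σ i, X i)) (y : Y) : S.run (v ++ w) y = S.run w (S.run v y) :=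
  List.foldl_append

theorem run_move_comm {i : I} {v : List (Σ i, X i)} (hv : ∀ a ∈ v, M i a.1 = 2) (x : X i) (y : Y) :
    S.run v (S.move i x y) = S.move i x (S.run v y) := by
  induction v generalizing y with
  | nil => rfl
  | cons a v ih =>
    rw [List.forall_mem_cons] at hv
    rw [run_cons, ← S.move_comm hv.1, ih hv.2, run_cons]

theorem run_cancel {i : I} {v : List (Σ i, X i)} (hv : ∀ a ∈ v, M i a.1 = 2) (u t : List (Σ i, X i))
    (x z : X i) (y : Y) :
    S.run (u ++ ⟨i, x⟩ :: (v ++ ⟨i, z⟩ :: t)) y = S.run (u ++ (v ++ ⟨i, z⟩ :: t)) y := by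
  simp only [run_append, run_cons, S.run_move_comm hv, S.move_move]

theorem run_stationary {u : List (Σ i, X i)} {a : Σ i, X i} {y : Y}
    (h : S.col (S.run u y) a.1 = a.2) (t : List (Σ i, X i)) :
    S.run (u ++ a :: t) y = S.run (u ++ t) y := by
  rw [run_append, run_cons, ← h, S.move_col, run_append]

variable {S T}

theorem col_move_eq_col_move {y : Y} {z : Z} (h : S.col y = T.col z) (i : I) (x : X i) :
    S.col (S.move i x y) = T.col (T.move i x z) := by
  funext j
  by_cases hj : j = i
  · subst hj
    rw [S.col_move_self, T.col_move_self]
  · rw [S.col_move_of_ne hj, T.col_move_of_ne hj, h]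

theorem col_run_eq_col_run {y : Y} {z : Z} (h : S.col y = T.col z) (w : List (Σ i, X i)) :
    S.col (S.run w y) = T.col (T.run w z) := by
  induction w generalizing y z with
  | nil => exact h
  | cons a _ ih => exact ih (col_move_eq_col_move h a.1 a.2)

theorem exists_reverse {y : Y} {z : Z} (h : S.col y = T.col z) (w : List (Σ i, X i)) :
    ∃ w', S.run w' (S.run w y) = y ∧ T.run w' (T.run w z) = z := by
  induction w generalizing y z with
  | nil => exact ⟨[], rfl, rfl⟩
  | cons a _ ih =>
    obtain ⟨w', hy, hz⟩ := ih (col_move_eq_col_move h a.1 a.2)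
    refine ⟨w' ++ [⟨a.1, S.col y a.1⟩], ?_, ?_⟩
    · simp only [run_append, run_cons, run_nil, hy, S.move_move, S.move_col]
    · simp only [run_append, run_cons, run_nil, hz, T.move_move, h, T.move_col]

end MoveSystem

namespace LegalColouring

variable {Δ : ChamberSystem I C} (L : Δ.LegalColouring X)

theorem move_comm (hM : M.IsRightAngled) (hΔ : Δ.IsBuilding M) {i j : I} (hij : M i j = 2)
    (x : X i) (y : X j) (c : C) :
    L.move i x (L.move j y c) = L.move j y (L.move i x c) := by
  have hne : i ≠ j := by
    rintro rfl
    simp at hij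
  by_cases hx : L.col c i = x
  · subst hx
    rw [move_col, ← L.col_move_of_ne hne y c, move_col]
  by_cases hy : L.col c j = y
  · subst hy
    rw [move_col, ← L.col_move_of_ne hne.symm x c, move_col]
  have hred : ∀ {a b : I}, a ≠ b → M.toCoxeterSystem.IsReduced [a, b] := by
    intro a b hab
    have hcomm : RightAngledCoxeter.CommReduced M [a, b] :=
      ⟨fun h => h.elim (fun h => hab h.symm) And.right, id, trivial⟩
    exact hcomm.isReduced hM
  obtain ⟨δ, hδ⟩ := hΔ.exists_dist
  -- The Weyl distance of the two ends of the gallery `j, i` also has the reduced word `i, j`.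
  have hji : Δ.IsGallery [j, i] c (L.move i x (L.move j y c)) := by
    refine ⟨_, fun h => hy ?_, L.equiv_move j y c, _, fun h => hx ?_, L.equiv_move i x _, rfl⟩
    · rw [h, col_move_self]
    · rw [← L.col_move_of_ne hne y c, h, col_move_self]
  have hword : M.toCoxeterSystem.wordProd [j, i] = M.toCoxeterSystem.wordProd [i, j] := by
    simpa [CoxeterSystem.wordProd_cons] using (RightAngledCoxeter.commute_simple hij).symm.eq
  have hdist := (hδ _ (hred hne.symm) _ _).2 hji
  rw [hword] at hdist
  obtain ⟨e, -, hce, _, -, hed, rfl⟩ := (hδ _ (hred hne) _ _).1 hdist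
  have hcol : L.col e i = x := by
    rw [L.col_eq_of_equiv hne hed, col_move_self]
  rw [← L.move_eq_of_equiv hed, ← L.move_eq_of_equiv hce, hcol, L.col_move_of_ne hne.symm,
    col_move_self]

/-- The chambers of a right-angled building, with the moves determined by a legal colouring. -/
noncomputable def moveSystem (hM : M.IsRightAngled) (hΔ : Δ.IsBuilding M) : MoveSystem M X C where
  col := L.col
  move := L.move
  move_col := L.move_col
  col_move_self := L.col_move_self
  col_move_of_ne := L.col_move_of_ne
  move_move := L.move_move
  move_comm := L.move_comm hM hΔ

theorem exists_run_eq (hM : M.IsRightAngled) (hΔ : Δ.IsBuilding M) (c d : C) :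
    ∃ w, (L.moveSystem hM hΔ).run w c = d := by
  induction d using L.induction_move hΔ c with
  | base => exact ⟨[], rfl⟩
  | step i x d hd =>
    obtain ⟨w, rfl⟩ := hd
    exact ⟨w ++ [⟨i, x⟩], by simp [moveSystem]⟩

theorem exists_stationary_or_isGallery (hM : M.IsRightAngled) (hΔ : Δ.IsBuilding M)
    (w : List (Σ i, X i)) (c : C) :
    (∃ u a t, w = u ++ a :: t ∧ L.col ((L.moveSystem hM hΔ).run u c) a.1 = a.2) ∨
      Δ.IsGallery (w.map Sigma.fst) c ((L.moveSystem hM hΔ).run w c) := by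
  induction w generalizing c with
  | nil => exact Or.inr rfl
  | cons a w ih =>
    by_cases ha : L.col c a.1 = a.2
    · exact Or.inl ⟨[], a, w, rfl, ha⟩
    rcases ih (L.move a.1 a.2 c) with ⟨u, b, t, rfl, hb⟩ | hgallery
    · exact Or.inl ⟨a :: u, b, t, rfl, hb⟩
    · refine Or.inr ⟨_, fun h => ha ?_, L.equiv_move a.1 a.2 c, hgallery⟩
      rw [h, col_move_self]

theorem exists_split_of_map_eq {w : List (Σ i, X i)} {i : I} {a v t : List I}
    (h : w.map Sigma.fst = a ++ i :: (v ++ i :: t)) :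
    ∃ (a' v' t' : List (Σ i, X i)) (x z : X i), w = a' ++ ⟨i, x⟩ :: (v' ++ ⟨i, z⟩ :: t') ∧
      v'.map Sigma.fst = v := by
  obtain ⟨a', r, rfl, -, hr⟩ := List.map_eq_append_iff.1 h
  obtain ⟨⟨_, x⟩, r, rfl, rfl, hr⟩ := List.map_eq_cons_iff.1 hr
  obtain ⟨v', r, rfl, hv, hr⟩ := List.map_eq_append_iff.1 hr
  obtain ⟨⟨j, z⟩, t', rfl, hj, -⟩ := List.map_eq_cons_iff.1 hr
  cases hj
  exact ⟨a', v', t', x, z, rfl, hv⟩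

theorem exists_split_of_run_eq (hM : M.IsRightAngled) (hΔ : Δ.IsBuilding M)
    {w : List (Σ i, X i)} {c : C} (hw : w ≠ []) (h : (L.moveSystem hM hΔ).run w c = c) :
    (∃ u a t, w = u ++ a :: t ∧ L.col ((L.moveSystem hM hΔ).run u c) a.1 = a.2) ∨
      ∃ u i x v z t, w = u ++ ⟨i, x⟩ :: (v ++ ⟨i, z⟩ :: t) ∧ ∀ a ∈ v, M i a.1 = 2 := by
  refine (L.exists_stationary_or_isGallery hM hΔ w c).imp_right fun hgallery => ?_
  rw [h] at hgallery
  have hnot : ¬ RightAngledCoxeter.CommReduced M (w.map Sigma.fst) := by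
    intro hcomm
    have hred := hcomm.isReduced hM
    obtain ⟨δ, hδ⟩ := hΔ.exists_dist
    have hnil : M.toCoxeterSystem.IsReduced [] := by simp [CoxeterSystem.IsReduced]
    have hone := ((hδ _ hred c c).2 hgallery).symm.trans ((hδ [] hnil c c).2 rfl)
    have hlength := hred.eq.symm
    rw [hone, CoxeterSystem.wordProd_nil, M.toCoxeterSystem.length_one] at hlength
    exact hw (List.map_eq_nil_iff.1 (List.eq_nil_of_length_eq_zero hlength))
  obtain ⟨a, i, v, t, hsplit, hv⟩ := RightAngledCoxeter.exists_split_of_not_commReduced hnot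
  obtain ⟨a, v, t, x, z, rfl, rfl⟩ := exists_split_of_map_eq hsplit
  exact ⟨a, i, x, v, z, t, rfl, fun b hb => hv _ (List.mem_map_of_mem hb)⟩

theorem run_eq_self (hM : M.IsRightAngled) (hΔ : Δ.IsBuilding M) (S : MoveSystem M X Y)
    {c : C} {y : Y} (hcol : S.col y = L.col c) {w : List (Σ i, X i)}
    (h : (L.moveSystem hM hΔ).run w c = c) : S.run w y = y := by
  induction hn : w.length using Nat.strong_induction_on generalizing w with
  | _ n ih =>
  subst hn
  rcases eq_or_ne w [] with rfl | hw
  · rfl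
  rcases L.exists_split_of_run_eq hM hΔ hw h with ⟨u, a, t, rfl, ha⟩ | ⟨u, i, x, v, z, t, rfl, hv⟩
  · have ha' : S.col (S.run u y) a.1 = a.2 := by
      rw [MoveSystem.col_run_eq_col_run (T := L.moveSystem hM hΔ) hcol]
      exact ha
    rw [S.run_stationary ha']
    rw [MoveSystem.run_stationary _ ha] at h
    exact ih _ (by simp) h rfl
  · rw [S.run_cancel hv]
    rw [MoveSystem.run_cancel _ hv] at h
    exact ih _ (by simp) h rfl

theorem run_eq_run (hM : M.IsRightAngled) (hΔ : Δ.IsBuilding M) (S : MoveSystem M X Y)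
    {c : C} {y : Y} (hcol : S.col y = L.col c) {v w : List (Σ i, X i)}
    (h : (L.moveSystem hM hΔ).run v c = (L.moveSystem hM hΔ).run w c) : S.run v y = S.run w y := by
  obtain ⟨w', hy, hc⟩ := MoveSystem.exists_reverse (T := L.moveSystem hM hΔ) hcol w
  have hclosed : (L.moveSystem hM hΔ).run (w' ++ v) ((L.moveSystem hM hΔ).run w c) =
      (L.moveSystem hM hΔ).run w c := by
    rw [MoveSystem.run_append, hc, h]
  have hS := L.run_eq_self hM hΔ S
    (MoveSystem.col_run_eq_col_run (T := L.moveSystem hM hΔ) hcol w) hclosed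
  rwa [MoveSystem.run_append, hy] at hS

theorem exists_map_move (hM : M.IsRightAngled) (hΔ : Δ.IsBuilding M) (S : MoveSystem M X Y)
    {c : C} {y : Y} (hcol : S.col y = L.col c) :
    ∃ φ : C → Y, φ c = y ∧ ∀ i x e, φ (L.move i x e) = S.move i x (φ e) := by
  choose w hw using L.exists_run_eq hM hΔ c
  refine ⟨fun e => S.run (w e) y, L.run_eq_self hM hΔ S hcol (hw c), fun i x e => ?_⟩
  have hrun : (L.moveSystem hM hΔ).run (w (L.move i x e)) c =
      (L.moveSystem hM hΔ).run (w e ++ [⟨i, x⟩]) c := by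
    rw [hw, MoveSystem.run_append, hw]
    rfl
  simpa using L.run_eq_run hM hΔ S hcol hrun

theorem eq_self_of_map_move (hΔ : Δ.IsBuilding M) {φ : C → C} {c : C} (hc : φ c = c)
    (hφ : ∀ i x e, φ (L.move i x e) = L.move i x (φ e)) (e : C) : φ e = e := by
  induction e using L.induction_move hΔ c with
  | base => exact hc
  | step i x e he => rw [hφ, he]

theorem col_eq_of_map_move (hΔ : Δ.IsBuilding M) (S : MoveSystem M X Y) {φ : C → Y} {c : C}
    (hc : S.col (φ c) = L.col c) (hφ : ∀ i x e, φ (L.move i x e) = S.move i x (φ e)) (e : C) :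
    S.col (φ e) = L.col e := by
  induction e using L.induction_move hΔ c with
  | base => exact hc
  | step i x e he =>
    funext j
    rw [hφ]
    by_cases hj : j = i
    · subst hj
      rw [S.col_move_self, col_move_self]
    · rw [S.col_move_of_ne hj, L.col_move_of_ne hj, he]

theorem equiv_of_map_move {L' : Δ.LegalColouring X} {φ : C → C}
    (hφ : ∀ i x e, φ (L'.move i x e) = L.move i x (φ e)) {i : I} {c d : C}
    (h : Δ.equiv i c d) : Δ.equiv i (φ c) (φ d) := by
  rw [← L'.move_eq_of_equiv h, hφ]
  exact L.equiv_move i _ _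

theorem exists_aut_col_eq (hM : M.IsRightAngled) (hΔ : Δ.IsBuilding M) (L' : Δ.LegalColouring X)
    {c d : C} (h : L'.col c = L.col d) :
    ∃ g : Δ.Aut, g • c = d ∧ ∀ e, L.col (g • e) = L'.col e := by
  obtain ⟨φ, hφc, hφ⟩ := L'.exists_map_move hM hΔ (L.moveSystem hM hΔ) h.symm
  obtain ⟨ψ, hψd, hψ⟩ := L.exists_map_move hM hΔ (L'.moveSystem hM hΔ) h
  have hψφ : Function.LeftInverse ψ φ := L'.eq_self_of_map_move hΔ (φ := ψ ∘ φ)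
    (by rw [Function.comp, hφc, hψd]) fun i x e => (congrArg ψ (hφ i x e)).trans (hψ i x _)
  have hφψ : Function.RightInverse ψ φ := L.eq_self_of_map_move hΔ (φ := φ ∘ ψ)
    (by rw [Function.comp, hψd, hφc]) fun i x e => (congrArg φ (hψ i x e)).trans (hφ i x _)
  let g : Equiv.Perm C := ⟨φ, ψ, hψφ, hφψ⟩
  have hg : g ∈ Δ.Aut := fun i e e' =>
    ⟨fun he => hψφ e ▸ hψφ e' ▸ L'.equiv_of_map_move hψ he, L.equiv_of_map_move hφ⟩
  have hcol : L.col (φ c) = L'.col c := by rw [hφc, h]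
  exact ⟨⟨g, hg⟩, hφc, L'.col_eq_of_map_move hΔ (L.moveSystem hM hΔ) hcol hφ⟩

variable {F : ∀ i, Subgroup (Equiv.Perm (X i))}

theorem smul_eq_move_of_equiv (g : Δ.Aut) {i : I} {c d : C} (h : Δ.equiv i c d) :
    g • d = L.move i (L.col (g • d) i) (g • c) :=
  (L.move_eq_of_equiv ((g.2 i c d).2 h)).symm

theorem smul_move (g : Δ.Aut) (i : I) (x : X i) (c : C) :
    g • L.move i x c = L.move i (L.localAction g (Δ.residueAt {i} c) x) (g • c) := by
  have hcol := L.localAction_col g (Δ.residueAt {i} c) _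
    (mem_panel_residueAt.2 (L.equiv_move i x c))
  rw [col_move_self] at hcol
  exact hcol ▸ L.smul_eq_move_of_equiv g (L.equiv_move i x c)

theorem exists_universalGroup_col_eq (hM : M.IsRightAngled) (hΔ : Δ.IsBuilding M)
    {col' : C → ∀ i, X i}
    (hF : ∀ i c, ∃ f ∈ F i, ∀ e, Δ.equiv i c e → col' e i = f (L.col e i))
    (hconst : ∀ {i j}, j ≠ i → ∀ {c d}, Δ.equiv i c d → col' c j = col' d j)
    {c d : C} (h : col' c = L.col d) :
    ∃ g : L.universalGroup F, g • c = d ∧ ∀ e, L.col (g • e) = col' e := by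
  have hpanel : ∀ {i} (P : Δ.Panel i), ∃ f ∈ F i, ∀ e ∈ P.1, col' e i = f (L.col e i) := by
    intro i P
    obtain ⟨c, rfl⟩ := residueAt_surjective P
    simpa only [mem_panel_residueAt] using hF i c
  let L' : Δ.LegalColouring X :=
    { col := col'
      bijective := fun i P => by
        obtain ⟨f, -, hf⟩ := hpanel P
        convert f.bijective.comp (L.bijective i P) using 1
        exact funext fun e => hf e e.2
      constant := fun i j hj P e he e' he' => by
        obtain ⟨c, rfl⟩ := residueAt_surjective P
        rw [mem_panel_residueAt] at he he'
        exact hconst hj (Setoid.trans' _ (Setoid.symm' _ he) he') }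
  obtain ⟨g, hgc, hg⟩ := L.exists_aut_col_eq hM hΔ L' h
  refine ⟨⟨g, fun i P => ?_⟩, hgc, hg⟩
  obtain ⟨f, hfF, hf⟩ := hpanel P
  convert hfF
  ext x
  obtain ⟨e, rfl⟩ := (L.bijective i P).2 x
  exact (L.localAction_col g P e e.2).trans ((congrFun (hg e) i).trans (hf e e.2))

theorem exists_universalGroup_recolour (hM : M.IsRightAngled) (hΔ : Δ.IsBuilding M) {k : I}
    {κ : C → X k} (hF : ∀ c, ∃ f ∈ F k, ∀ e, Δ.equiv k c e → κ e = f (L.col e k))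
    (hconst : ∀ i, i ≠ k → Δ.equiv i ≤ Setoid.ker κ) (c : C) :
    ∃ g : L.universalGroup F, g • c = L.move k (κ c) c ∧ (∀ e, L.col (g • e) k = κ e) ∧
      ∀ i, i ≠ k → ∀ e, L.col (g • e) i = L.col e i := by
  classical
  let col' : C → ∀ i, X i := fun e => Function.update (L.col e) k (κ e)
  have hF' : ∀ i c, ∃ f ∈ F i, ∀ e, Δ.equiv i c e → col' e i = f (L.col e i) := by
    intro i c
    by_cases hi : i = k
    · subst hi
      simpa only [col', Function.update_self] using hF c
    · exact ⟨1, one_mem _, fun e _ => Function.update_of_ne hi ..⟩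
  have hconst' : ∀ {i j}, j ≠ i → ∀ {c d}, Δ.equiv i c d → col' c j = col' d j := by
    intro i j hj c d h
    by_cases hjk : j = k
    · subst hjk
      simpa only [col', Function.update_self] using Setoid.ker_def.1 (hconst i hj.symm h)
    · simpa only [col', Function.update_of_ne hjk] using L.col_eq_of_equiv hj h
  have hcol : col' c = L.col (L.move k (κ c) c) := by
    refine Function.update_eq_iff.2 ⟨(L.col_move_self ..).symm, fun i hi => ?_⟩
    exact (L.col_move_of_ne hi ..).symm
  obtain ⟨g, hgc, hg⟩ := L.exists_universalGroup_col_eq hM hΔ hF' hconst' hcol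
  exact ⟨g, hgc, fun e => (congrFun (hg e) k).trans (Function.update_self ..),
    fun i hi e => (congrFun (hg e) i).trans (Function.update_of_ne hi ..)⟩

theorem exists_universalGroup_extend (hM : M.IsRightAngled) (hΔ : Δ.IsBuilding M) {i : I}
    {f : Equiv.Perm (X i)} (hf : f ∈ F i) (c : C) :
    ∃ g : L.universalGroup F, g • c = L.move i (f (L.col c i)) c ∧
      ∀ e, L.col (g • e) i = f (L.col e i) := by
  obtain ⟨g, hgc, hg, -⟩ := L.exists_universalGroup_recolour hM hΔ
    (κ := fun e => f (L.col e i)) (fun _ => ⟨f, hf, fun _ _ => rfl⟩)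
    (fun _ hj _ _ h => congrArg f (L.col_eq_of_equiv hj.symm h)) c
  exact ⟨g, hgc, hg⟩

end LegalColouring

variable {k : I}

open Classical in
/-- The product of a move system with a group `A`, in which every `k`-move also adds the change of
`θ` to the second coordinate. -/
noncomputable def MoveSystem.twist {A : Type*} [AddGroup A] (S : MoveSystem M X Y) {θ : Y → A}
    (hθ : ∀ {i}, M i k = 2 → ∀ x y, θ (S.move i x y) = θ y) : MoveSystem M X (Y × A) where
  col p := S.col p.1
  move i x p := (S.move i x p.1, if i = k then p.2 - θ p.1 + θ (S.move i x p.1) else p.2)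
  move_col i p := by simp [S.move_col]
  col_move_self i x p := S.col_move_self i x p.1
  col_move_of_ne hj x p := S.col_move_of_ne hj x p.1
  move_move i x x' p := by
    by_cases hi : i = k <;> simp [hi, S.move_move]
  move_comm {i j} hij x x' p := by
    have hne : i ≠ j := by
      rintro rfl
      simp at hij
    by_cases hi : i = k
    · subst hi
      have hji := (M.symmetric j i).trans hij
      simp [hne.symm, S.move_comm hij, hθ hji]
    · by_cases hj : j = k
      · subst hj
        simp [hne, ← S.move_comm hij, hθ hij]
      · simp [hi, hj, S.move_comm hij]

variable (Δ : ChamberSystem I C)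

variable (M k) in
/-- The equivalence relation whose classes are the tree-walls of type `k`, the residues of type
`{k} ∪ {j | m_{jk} = 2}`. -/
def treeWall : Setoid C := Δ.residueSetoid {j | j = k ∨ M j k = 2}

variable {Δ}

theorem equiv_le_treeWall {j : I} (hj : j = k ∨ M j k = 2) : Δ.equiv j ≤ Δ.treeWall M k :=
  equiv_le_residueSetoid (J := {j | j = k ∨ M j k = 2}) hj

namespace LegalColouring

variable (L : Δ.LegalColouring X)

theorem exists_twisted_colouring (hM : M.IsRightAngled) (hΔ : Δ.IsBuilding M) {A : Type*}
    [AddGroup A] {θ : C → A} (hθ : ∀ {i}, M i k = 2 → ∀ x c, θ (L.move i x c) = θ c) (b : C)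
    (a : A) :
    ∃ π : C → A, π b = a ∧ (∀ i, i ≠ k → ∀ x c, π (L.move i x c) = π c) ∧
      ∀ x c, π (L.move k x c) = π c - θ c + θ (L.move k x c) := by
  obtain ⟨φ, hb, hφ⟩ := L.exists_map_move hM hΔ ((L.moveSystem hM hΔ).twist hθ)
    (c := b) (y := (b, a)) rfl
  have hfst : ∀ c, (φ c).1 = c := L.eq_self_of_map_move hΔ (φ := fun c => (φ c).1)
    (c := b) (congrArg Prod.fst hb) fun i x c => congrArg Prod.fst (hφ i x c)
  have hsnd := fun i x c => congrArg Prod.snd (hφ i x c)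
  refine ⟨fun c => (φ c).2, congrArg Prod.snd hb, fun i hi x c => ?_, fun x c => ?_⟩
  · simpa only [MoveSystem.twist, if_neg hi] using hsnd i x c
  · refine (hsnd k x c).trans ?_
    simp only [MoveSystem.twist, moveSystem, if_true, hfst]

variable (M k) in
/-- `π` records, for every chamber `c`, the `k`-colour of the projection of `c` to the `k`-panel
of `b`. Its fibres are the wings of this panel, and it changes only by `k`-moves inside the
tree-wall of `b`. -/
structure IsWingColouring (b : C) (π : C → X k) : Prop where
  eq_col : ∀ {c}, Δ.treeWall M k b c → π c = L.col c k
  map_move : ∀ {i c}, ¬ (i = k ∧ Δ.treeWall M k b c) → ∀ x, π (L.move i x c) = π c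

variable {L}

theorem treeWall_move {b c : C} {j : I} (hj : j = k ∨ M j k = 2) {x : X j} :
    Δ.treeWall M k b (L.move j x c) ↔ Δ.treeWall M k b c := by
  have h : Δ.treeWall M k c (L.move j x c) := equiv_le_treeWall hj (L.equiv_move j x c)
  exact ⟨fun hb => Setoid.trans' _ hb (Setoid.symm' _ h), fun hb => Setoid.trans' _ hb h⟩

theorem residueSetoid_of_treeWall (hM : M.IsRightAngled) (hΔ : Δ.IsBuilding M) {c d : C}
    (h : Δ.treeWall M k c d) (hcol : L.col c k = L.col d k) : Δ.residueSetoid {k}ᶜ c d := by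
  have hle : Δ.treeWall M k ≤ (Δ.residueSetoid {k}ᶜ).comap (L.move k (L.col c k)) := by
    refine L.residueSetoid_le_iff.2 fun j hj x e => ?_
    rw [Setoid.comap_rel]
    rcases eq_or_ne j k with rfl | hjk
    · rw [move_move]
    · rw [← L.move_comm hM hΔ (hj.resolve_left hjk)]
      exact L.residueSetoid_move hjk x _
  have hmove := hle h
  rwa [Setoid.comap_rel, move_col, hcol, move_col] at hmove

theorem col_eq_of_treeWall {c d : C} (h : Δ.treeWall M k c d) {i : I} (hik : M i k = 0) :
    L.col c i = L.col d i :=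
  L.col_eq_of_residueSetoid (by
    rintro (rfl | hi)
    · simp at hik
    · simp [hik] at hi) h

theorem exists_isWingColouring (hM : M.IsRightAngled) (hΔ : Δ.IsBuilding M) (b : C) :
    ∃ π, L.IsWingColouring M k b π := by
  classical
  have : Nonempty (X k) := ⟨L.col b k⟩
  -- Any group structure allows the `k`-colours to be added up along the `k`-moves in the wall.
  obtain ⟨_⟩ := nonempty_commRing (α := X k)
  let θ : C → X k := fun c => if Δ.treeWall M k b c then L.col c k else 0
  have hθ : ∀ {i}, M i k = 2 → ∀ x c, θ (L.move i x c) = θ c := by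
    intro i hi x c
    have hne : k ≠ i := by
      rintro rfl
      simp at hi
    simp only [θ, treeWall_move (Or.inr hi), L.col_move_of_ne hne]
  obtain ⟨π, hb, hπ_of_ne, hπ_self⟩ := L.exists_twisted_colouring hM hΔ hθ b (L.col b k)
  have hwall : ∀ {c}, Δ.treeWall M k b c → π c = L.col c k := by
    refine L.residueSetoid_induction (p := fun c => π c = L.col c k) hb fun i hi x c hc hπc => ?_
    rcases eq_or_ne i k with rfl | hik
    · have hθc : θ c = L.col c i := if_pos hc
      have hθm : θ (L.move i x c) = x := by
        simp only [θ, if_pos ((treeWall_move hi).2 hc), col_move_self]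
      rw [hπ_self, hθm, hθc, hπc, sub_self, zero_add, col_move_self]
    · rw [hπ_of_ne i hik, hπc, L.col_move_of_ne hik.symm]
  refine ⟨π, hwall, fun {i c} hic x => ?_⟩
  rcases eq_or_ne i k with rfl | hik
  · have hc : ¬ Δ.treeWall M i b c := fun hc => hic ⟨rfl, hc⟩
    have hθc : θ c = 0 := if_neg hc
    have hθm : θ (L.move i x c) = 0 := if_neg fun h => hc ((treeWall_move (Or.inl rfl)).1 h)
    rw [hπ_self, hθm, hθc, sub_zero, add_zero]
  · exact hπ_of_ne i hik x c

theorem residueSetoid_or_exists_isWingColouring_ne (hM : M.IsRightAngled) (hΔ : Δ.IsBuilding M)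
    (b c : C) :
    Δ.residueSetoid {k}ᶜ b c ∨
      ∃ d, Δ.residueSetoid {k}ᶜ b d ∧ ∃ π, L.IsWingColouring M k d π ∧ π c ≠ L.col d k := by
  induction c using L.induction_move hΔ b with
  | base => exact Or.inl (Setoid.refl' _ b)
  | step i x c hc =>
    rcases hc with hbc | ⟨d, hbd, π, hπ, hne⟩
    · by_cases hi : i = k
      · subst hi
        by_cases hx : L.col c i = x
        · exact Or.inl (by rwa [← hx, move_col])
        · obtain ⟨π, hπ⟩ := exists_isWingColouring (L := L) (k := i) hM hΔ c
          refine Or.inr ⟨c, hbc, π, hπ, ?_⟩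
          rw [hπ.eq_col ((treeWall_move (Or.inl rfl)).2 (Setoid.refl' _ c)), col_move_self]
          exact Ne.symm hx
      · exact Or.inl (Setoid.trans' _ hbc (L.residueSetoid_move hi x c))
    · by_cases hic : i = k ∧ Δ.treeWall M k d c
      · obtain ⟨rfl, hdc⟩ := hic
        have hdm := (treeWall_move (L := L) (x := x) (Or.inl rfl)).2 hdc
        by_cases hx : L.col d i = x
        · exact Or.inl (Setoid.trans' _ hbd
            (residueSetoid_of_treeWall hM hΔ hdm (by rw [hx, col_move_self])))
        · refine Or.inr ⟨d, hbd, π, hπ, ?_⟩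
          rw [hπ.eq_col hdm, col_move_self]
          exact Ne.symm hx
      · exact Or.inr ⟨d, hbd, π, hπ, by rwa [hπ.map_move hic]⟩

end LegalColouring

theorem isPreprimitive_residue_iff {G : Subgroup Δ.Aut} {J : Set I} :
    MulAction.IsPreprimitive G (Δ.Residue J) ↔ MulAction.IsPretransitive G (Δ.Residue J) ∧
      ∀ E : Setoid C, Δ.residueSetoid J ≤ E → (∀ g : G, E ≤ E.comap (g • ·)) →
        E = Δ.residueSetoid J ∨ E = ⊤ := by
  simpa only [ker_residueAt] using isPreprimitive_iff_forall_setoid_of_surjective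
    (p := Δ.residueAt J) residueAt_surjective fun (g : G) c => (smul_residueAt g.1 c).symm

theorem isPretransitive_residue_iff {G : Subgroup Δ.Aut} {J : Set I} :
    MulAction.IsPretransitive G (Δ.Residue J) ↔
      ∀ c d, ∃ g : G, Δ.residueSetoid J (g • c) d := by
  have hsmul : ∀ (g : G) c d,
      g • Δ.residueAt J c = Δ.residueAt J d ↔ Δ.residueSetoid J (g • c) d := fun g c d => by
    rw [← ker_residueAt, Setoid.ker_def]
    exact (smul_residueAt g.1 c).congr_left
  rw [MulAction.isPretransitive_iff, residueAt_surjective.forall₂]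
  simp only [hsmul]

namespace LegalColouring

variable {L : Δ.LegalColouring X} {F : ∀ i, Subgroup (Equiv.Perm (X i))}

theorem nontrivial_colours (L : Δ.LegalColouring X) (hΔ : Δ.IsBuilding M) (i : I) :
    Nontrivial (X i) := by
  obtain ⟨c⟩ := hΔ.nonempty
  have : Nontrivial (Δ.residueAt {i} c).1 := (hΔ.two_le_panel i _).coe_sort
  exact (L.panelEquiv (Δ.residueAt {i} c)).symm.nontrivial

theorem exists_col_eq (L : Δ.LegalColouring X) (hΔ : Δ.IsBuilding M) {i : I} (x : X i) :
    ∃ c, L.col c i = x := by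
  obtain ⟨c⟩ := hΔ.nonempty
  exact ⟨L.move i x c, L.col_move_self i x c⟩

theorem exists_mem_col_smul_eq (g : L.universalGroup F) (i : I) (c : C) :
    ∃ f ∈ F i, L.col (g • c) i = f (L.col c i) ∧
      ∀ d, Δ.equiv i c d → L.col (g • d) i = f (L.col d i) := by
  have hcol : ∀ d, Δ.equiv i c d →
      L.col (g • d) i = L.localAction g.1 (Δ.residueAt {i} c) (L.col d i) :=
    fun d hd => (L.localAction_col g.1 _ d (mem_panel_residueAt.2 hd)).symm
  exact ⟨_, g.2 i (Δ.residueAt {i} c), hcol c (Setoid.refl' _ c), hcol⟩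

section Wings

variable {b : C} {π : C → X k}

theorem IsWingColouring.residueSetoid_le_ker (hπ : L.IsWingColouring M k b π) :
    Δ.residueSetoid {k}ᶜ ≤ Setoid.ker π :=
  L.residueSetoid_le_iff.2 fun _ hi x _ => (hπ.map_move (fun h => hi h.1) x).symm

theorem IsWingColouring.map_move_base (hπ : L.IsWingColouring M k b π) (x : X k) :
    π (L.move k x b) = x := by
  rw [hπ.eq_col ((treeWall_move (Or.inl rfl)).2 (Setoid.refl' _ b)), col_move_self]

theorem IsWingColouring.exists_mem_forall_ite_eq (hπ : L.IsWingColouring M k b π)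
    {f : Equiv.Perm (X k)} (hf : f ∈ F k) {x : X k} (hx : f x = x) [DecidableEq (X k)] (c : C) :
    ∃ f' ∈ F k, ∀ e, Δ.equiv k c e →
      (if π e = x then L.col e k else f (L.col e k)) = f' (L.col e k) := by
  by_cases hc : Δ.treeWall M k b c
  · refine ⟨f, hf, fun e he => ?_⟩
    rw [hπ.eq_col (Setoid.trans' _ hc (equiv_le_treeWall (Or.inl rfl) he))]
    split_ifs with h
    · rw [h, hx]
    · rfl
  · have hπe : ∀ e, Δ.equiv k c e → π e = π c := fun e he => by
      rw [← L.move_eq_of_equiv he, hπ.map_move fun h => hc h.2]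
    by_cases hcx : π c = x
    · exact ⟨1, one_mem _, fun e he => if_pos ((hπe e he).trans hcx)⟩
    · exact ⟨f, hf, fun e he => if_neg fun h => hcx ((hπe e he).symm.trans h)⟩

theorem IsWingColouring.smul_eq_of_col_smul_eq (hM : M.IsRightAngled) (hΔ : Δ.IsBuilding M)
    (hπ : L.IsWingColouring M k b π) {g : Δ.Aut} {x : X k}
    (hcol : ∀ i c, π c = x → L.col (g • c) i = L.col c i)
    (hg : g • L.move k x b = L.move k x b) (c : C) (hc : π c = x) : g • c = c := by
  have hfix : ∀ {i c d}, Δ.equiv i c d → g • c = c → π d = x → g • d = d := by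
    intro i c d hcd hc hd
    rw [L.smul_eq_move_of_equiv g hcd, hc, hcol i d hd, L.move_eq_of_equiv hcd]
  have hres : ∀ {c}, Δ.residueSetoid {k}ᶜ (L.move k x b) c → g • c = c := by
    refine L.residueSetoid_induction (p := fun c => g • c = c) hg fun i hi y c hbc hc => ?_
    refine hfix (L.equiv_move i y c) hc ?_
    rw [hπ.map_move fun h => hi h.1, ← Setoid.ker_def.1 (hπ.residueSetoid_le_ker hbc),
      hπ.map_move_base]
  induction c using L.induction_move hΔ (L.move k x b) with
  | base => exact hg
  | step i y c ih =>
    by_cases hic : i = k ∧ Δ.treeWall M k b c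
    · obtain ⟨rfl, hbc⟩ := hic
      have hwall := (treeWall_move (L := L) (x := y) (Or.inl rfl)).2 hbc
      have hbase : Δ.treeWall M i b (L.move i x b) :=
        (treeWall_move (Or.inl rfl)).2 (Setoid.refl' _ b)
      refine hres (residueSetoid_of_treeWall (L := L) hM hΔ
        (Setoid.trans' _ (Setoid.symm' _ hbase) hwall) ?_)
      rw [← hπ.eq_col hwall, hc, col_move_self]
    · exact hfix (L.equiv_move i y c) (ih (by rwa [← hπ.map_move hic y])) hc

theorem IsWingColouring.exists_universalGroup_fix (hM : M.IsRightAngled) (hΔ : Δ.IsBuilding M)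
    (hπ : L.IsWingColouring M k b π) {f : Equiv.Perm (X k)} (hf : f ∈ F k) {x : X k}
    (hx : f x = x) :
    ∃ g : L.universalGroup F, g • b = L.move k (f (L.col b k)) b ∧
      ∀ c, π c = x → g • c = c := by
  classical
  let κ : C → X k := fun c => if π c = x then L.col c k else f (L.col c k)
  have hconst : ∀ i, i ≠ k → Δ.equiv i ≤ Setoid.ker κ := fun i hi c d h => by
    have hπcd : π c = π d := hπ.residueSetoid_le_ker (equiv_le_residueSetoid hi h)
    simp only [κ, Setoid.ker_def, hπcd, L.col_eq_of_equiv hi.symm h]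
  obtain ⟨g, hga, hgk, hgi⟩ := L.exists_universalGroup_recolour hM hΔ
    (hπ.exists_mem_forall_ite_eq hf hx) hconst (L.move k x b)
  have hga : g • L.move k x b = L.move k x b := by
    rw [hga, if_pos (hπ.map_move_base x), move_col]
  refine ⟨g, ?_, hπ.smul_eq_of_col_smul_eq hM hΔ (fun i c hc => ?_) hga⟩
  · have hgb := L.smul_eq_move_of_equiv g.1 (Setoid.symm' _ (L.equiv_move k x b))
    have hcol : L.col (g • b) k = f (L.col b k) := by
      rw [hgk, hπ.eq_col (Setoid.refl' _ b)]
      split_ifs with hb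
      · rw [hb, hx]
      · rfl
    refine hgb.trans ((congrArg₂ (L.move k) hcol hga).trans ?_)
    rw [move_move]
  · by_cases hi : i = k
    · subst hi
      exact (hgk c).trans (if_pos hc)
    · exact hgi i hi c

end Wings

section Necessity

theorem exists_compl_eq_singleton_of_isPreprimitive (hΔ : Δ.IsBuilding M) {J : Set I}
    (hJ : J ⊂ Set.univ) (h : MulAction.IsPreprimitive (L.universalGroup F) (Δ.Residue J)) :
    ∃ k, Jᶜ = {k} := by
  obtain ⟨k, -, hkJ⟩ := Set.exists_of_ssubset hJ
  refine ⟨k, Set.eq_singleton_iff_unique_mem.2 ⟨hkJ, fun l hl => ?_⟩⟩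
  by_contra hlk
  obtain ⟨c⟩ := hΔ.nonempty
  have hmove : ∀ (i : I) {J' : Set I}, i ∉ J' → ∃ d, Δ.equiv i c d ∧ ¬ Δ.residueSetoid J' c d := by
    intro i J' hi
    have := L.nontrivial_colours hΔ i
    obtain ⟨x, hx⟩ := exists_ne (L.col c i)
    refine ⟨_, L.equiv_move i x c, fun hd => hx ?_⟩
    rw [L.col_eq_of_residueSetoid hi hd, col_move_self]
  have hle : Δ.residueSetoid J ≤ Δ.residueSetoid {l}ᶜ := ChamberSystem.residueSetoid_le_iff.2
    fun i hi => equiv_le_residueSetoid (ne_of_mem_of_not_mem hi hl)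
  rcases (isPreprimitive_residue_iff.1 h).2 _ hle fun g _ _ hcd => residueSetoid_smul g.1 hcd
    with heq | htop
  · obtain ⟨d, hcd, hd⟩ := hmove k hkJ
    exact hd (heq ▸ equiv_le_residueSetoid (J := {l}ᶜ) (Ne.symm hlk) hcd)
  · obtain ⟨d, -, hd⟩ := hmove l (J' := {l}ᶜ) (by simp)
    exact hd (htop ▸ trivial)

theorem forall_eq_or_forall_eq_top_of_isPreprimitive (hM : M.IsRightAngled) (hΔ : Δ.IsBuilding M)
    (h : MulAction.IsPreprimitive (L.universalGroup F) (Δ.Residue {k}ᶜ)) {Q : C → C → Prop}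
    (hQ : ∀ (g : L.universalGroup F) c d, Δ.equiv k c d → Q c d → Q (g • c) (g • d)) :
    (∀ c d, Δ.equiv k c d → Q c d → c = d) ∨
      ∀ b (r : Setoid (X k)), (∀ c d, Δ.treeWall M k b c → Δ.equiv k c d → Q c d →
        r (L.col c k) (L.col d k)) → r = ⊤ := by
  let R : C → C → Prop := fun c d => Δ.residueSetoid {k}ᶜ c d ∨ Δ.equiv k c d ∧ Q c d
  have hR : ∀ g : L.universalGroup F,
      Relation.EqvGen.setoid R ≤ (Relation.EqvGen.setoid R).comap (g • ·) := fun g =>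
    Setoid.eqvGen_le fun c d hcd => Relation.EqvGen.rel (r := R) _ _
      (hcd.imp (residueSetoid_smul g.1) fun ⟨hkcd, hQcd⟩ =>
        ⟨(g.1.2 k c d).2 hkcd, hQ g c d hkcd hQcd⟩)
  refine ((isPreprimitive_residue_iff.1 h).2 _
    (fun c d hcd => Relation.EqvGen.rel (r := R) c d (Or.inl hcd)) hR).imp
    (fun heq c d hcd hQcd => ?_) fun htop b r hr => ?_
  · have hrel : Relation.EqvGen.setoid R c d := Relation.EqvGen.rel _ _ (Or.inr ⟨hcd, hQcd⟩)
    rw [heq] at hrel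
    exact L.eq_of_equiv_of_col_eq hcd (L.col_eq_of_residueSetoid (by simp) hrel)
  · obtain ⟨π, hπ⟩ := exists_isWingColouring (L := L) (k := k) hM hΔ b
    have hle : Relation.EqvGen.setoid R ≤ r.comap π := by
      refine Setoid.eqvGen_le fun c d hcd => ?_
      rw [Setoid.comap_rel]
      rcases hcd with hcd | ⟨hcd, hQcd⟩
      · rw [Setoid.ker_def.1 (hπ.residueSetoid_le_ker hcd)]
      · by_cases hbc : Δ.treeWall M k b c
        · rw [hπ.eq_col hbc, hπ.eq_col (Setoid.trans' _ hbc (equiv_le_treeWall (Or.inl rfl) hcd))]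
          exact hr c d hbc hcd hQcd
        · rw [← L.move_eq_of_equiv hcd, hπ.map_move fun h => hbc h.2]
    refine eq_top_iff.2 fun x y _ => ?_
    have hxy := hle (x := L.move k x b) (y := L.move k y b) (htop ▸ trivial)
    rwa [Setoid.comap_rel, hπ.map_move_base, hπ.map_move_base] at hxy

theorem isPretransitive_of_isPretransitive_residue (hΔ : Δ.IsBuilding M)
    (h : MulAction.IsPretransitive (L.universalGroup F) (Δ.Residue {k}ᶜ)) :
    MulAction.IsPretransitive (F k) (X k) := by
  refine ⟨fun x y => ?_⟩
  obtain ⟨c, rfl⟩ := L.exists_col_eq hΔ x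
  obtain ⟨d, rfl⟩ := L.exists_col_eq hΔ y
  obtain ⟨g, hg⟩ := isPretransitive_residue_iff.1 h c d
  obtain ⟨f, hf, hcol, -⟩ := exists_mem_col_smul_eq g k c
  exact ⟨⟨f, hf⟩, hcol.symm.trans (L.col_eq_of_residueSetoid (by simp) hg)⟩

theorem isPreprimitive_of_isPreprimitive_residue (hM : M.IsRightAngled) (hΔ : Δ.IsBuilding M)
    (h : MulAction.IsPreprimitive (L.universalGroup F) (Δ.Residue {k}ᶜ)) :
    MulAction.IsPreprimitive (F k) (X k) := by
  refine isPreprimitive_iff_forall_setoid.2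
    ⟨isPretransitive_of_isPretransitive_residue hΔ h.toIsPretransitive, fun r hr => ?_⟩
  have hQ : ∀ (g : L.universalGroup F) (c d : C), Δ.equiv k c d → r (L.col c k) (L.col d k) →
      r (L.col (g • c) k) (L.col (g • d) k) := by
    intro g c d hcd hrcd
    obtain ⟨f, hf, hc, hpanel⟩ := exists_mem_col_smul_eq g k c
    rw [hc, hpanel d hcd]
    exact hr ⟨f, hf⟩ hrcd
  refine (forall_eq_or_forall_eq_top_of_isPreprimitive hM hΔ h hQ).imp
    (fun heq => eq_bot_iff.2 fun x y hxy => ?_) fun htop => ?_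
  · obtain ⟨c, rfl⟩ := L.exists_col_eq hΔ x
    have hc := heq c (L.move k y c) (L.equiv_move k y c) (by rwa [col_move_self])
    exact (congrArg (L.col · k) hc).trans (L.col_move_self k y c)
  · obtain ⟨b⟩ := hΔ.nonempty
    exact htop b r fun _ _ _ _ h => h

theorem isPretransitive_of_isPreprimitive_residue (hM : M.IsRightAngled) (hΔ : Δ.IsBuilding M)
    (h : MulAction.IsPreprimitive (L.universalGroup F) (Δ.Residue {k}ᶜ)) {i : I}
    (hik : M i k = 0) : MulAction.IsPretransitive (F i) (X i) := by
  refine ⟨fun x y => ?_⟩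
  by_contra! hxy
  have := L.nontrivial_colours hΔ k
  have hQ : ∀ (g : L.universalGroup F) (c d : C), Δ.equiv k c d → (∃ f : F i, f • x = L.col c i) →
      ∃ f : F i, f • x = L.col (g • c) i := by
    rintro g c d - ⟨f, hf⟩
    obtain ⟨f', hf', hcol, -⟩ := exists_mem_col_smul_eq g i c
    exact ⟨⟨f', hf'⟩ * f, by rw [mul_smul, hf, hcol]; rfl⟩
  rcases forall_eq_or_forall_eq_top_of_isPreprimitive hM hΔ h
    (Q := fun c _ => ∃ f : F i, f • x = L.col c i) hQ with heq | htop
  · obtain ⟨c, rfl⟩ := L.exists_col_eq hΔ x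
    obtain ⟨z, hz⟩ := exists_ne (L.col c k)
    have hc := heq c (L.move k z c) (L.equiv_move k z c) ⟨1, one_smul _ _⟩
    exact hz (by rw [hc, col_move_self])
  · obtain ⟨b, rfl⟩ := L.exists_col_eq hΔ y
    obtain ⟨z, z', hzz'⟩ := exists_pair_ne (X k)
    have hbot := htop b ⊥ fun c d hbc _ ⟨f, hf⟩ =>
      absurd (hf.trans (col_eq_of_treeWall hbc hik).symm) (hxy f)
    exact hzz' (hbot ▸ trivial : (⊥ : Setoid (X k)) z z')

theorem exists_forall_col_smul_eq_of_isRegularAction (hΔ : Δ.IsBuilding M)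
    (hreg : IsRegularAction (F k) (X k)) (g : L.universalGroup F) :
    ∃ f : Equiv.Perm (X k), ∀ c, L.col (g • c) k = f (L.col c k) := by
  obtain ⟨b⟩ := hΔ.nonempty
  obtain ⟨f, hf, hb, -⟩ := exists_mem_col_smul_eq g k b
  refine ⟨f, fun c => ?_⟩
  induction c using L.induction_move hΔ b with
  | base => exact hb
  | step i x c hc =>
    by_cases hi : i = k
    · subst hi
      obtain ⟨f', hf', hc', hpanel⟩ := exists_mem_col_smul_eq g i c
      have := isCancelSMul_iff_stabilizer_eq_bot.2 hreg.2
      have hff' : f' = f := congrArg Subtype.val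
        (IsCancelSMul.right_cancel (⟨f', hf'⟩ : F i) ⟨f, hf⟩ (L.col c i) (hc'.symm.trans hc))
      rw [hpanel _ (L.equiv_move i x c), hff']
    · have hequiv := (g.1.2 i _ _).2 (L.equiv_move i x c)
      rw [L.col_move_of_ne (Ne.symm hi), ← hc]
      exact (L.col_eq_of_equiv (Ne.symm hi) hequiv).symm

theorem not_isRegularAction_of_isPreprimitive_residue (hM : M.IsRightAngled)
    (hΔ : Δ.IsBuilding M) {i : I} (hik : M i k = 0)
    (h : MulAction.IsPreprimitive (L.universalGroup F) (Δ.Residue {k}ᶜ)) :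
    ¬ IsRegularAction (F k) (X k) := by
  intro hreg
  obtain ⟨b⟩ := hΔ.nonempty
  have := L.nontrivial_colours hΔ k
  have := L.nontrivial_colours hΔ i
  obtain ⟨y, hy⟩ := exists_ne (L.col b k)
  obtain ⟨z, hz⟩ := exists_ne (L.col b i)
  have hle : Δ.residueSetoid {k}ᶜ ≤ Setoid.ker (L.col · k) :=
    fun c d hcd => L.col_eq_of_residueSetoid (by simp) hcd
  have hinv : ∀ g : L.universalGroup F,
      Setoid.ker (L.col · k) ≤ (Setoid.ker (L.col · k)).comap (g • ·) := fun g c d hcd => by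
    obtain ⟨f, hf⟩ := exists_forall_col_smul_eq_of_isRegularAction hΔ hreg g
    rw [Setoid.comap_rel, Setoid.ker_def, hf, hf, Setoid.ker_def.1 hcd]
  rcases (isPreprimitive_residue_iff.1 h).2 _ hle hinv with heq | htop
  · obtain ⟨π, hπ⟩ := exists_isWingColouring (L := L) (k := k) hM hΔ b
    have hik' : i ≠ k := by
      rintro rfl
      simp at hik
    have hwall : ¬ Δ.treeWall M k b (L.move i z b) := fun hb =>
      hz ((col_eq_of_treeWall hb hik).trans (L.col_move_self i z b)).symm
    have hcol : Setoid.ker (L.col · k) (L.move k y b) (L.move k y (L.move i z b)) := by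
      simp only [Setoid.ker_def, col_move_self]
    have hπeq := hπ.residueSetoid_le_ker (heq ▸ hcol)
    rw [Setoid.ker_def, hπ.map_move_base, hπ.map_move fun h => hwall h.2,
      hπ.map_move fun h => hik' h.1, hπ.eq_col (Setoid.refl' _ b)] at hπeq
    exact hy hπeq
  · have hb : Setoid.ker (L.col · k) b (L.move k y b) := htop ▸ trivial
    exact hy ((L.col_move_self k y b).symm.trans (Setoid.ker_def.1 hb).symm)

end Necessity

section Sufficiency

theorem isPretransitive_residue (hM : M.IsRightAngled) (hΔ : Δ.IsBuilding M)
    (h : MulAction.IsPretransitive (F k) (X k)) :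
    MulAction.IsPretransitive (L.universalGroup F) (Δ.Residue {k}ᶜ) := by
  refine isPretransitive_residue_iff.2 fun c d => ?_
  induction d using L.induction_move hΔ c with
  | base => exact ⟨1, Setoid.refl' _ c⟩
  | step i x d hd =>
    obtain ⟨g, hg⟩ := hd
    by_cases hi : i = k
    · subst hi
      obtain ⟨⟨f, hf⟩, hfx⟩ := h.exists_smul_eq (L.col d i) x
      obtain ⟨g', hg', -⟩ := L.exists_universalGroup_extend hM hΔ hf d
      have hg'd : g' • d = L.move i x d := hg'.trans (congrArg (L.move i · d) hfx)
      exact ⟨g' * g, hg'd ▸ residueSetoid_smul g'.1 hg⟩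
    · exact ⟨g, Setoid.trans' _ hg (L.residueSetoid_move hi x d)⟩

variable {E : Setoid C}

theorem exists_rel_move_of_ne_residueSetoid (hM : M.IsRightAngled) (hΔ : Δ.IsBuilding M)
    (hp : MulAction.IsPreprimitive (F k) (X k)) (hr : ¬ IsRegularAction (F k) (X k))
    (hle : Δ.residueSetoid {k}ᶜ ≤ E) (hE : ∀ g : L.universalGroup F, E ≤ E.comap (g • ·))
    (hne : E ≠ Δ.residueSetoid {k}ᶜ) : ∃ d x, x ≠ L.col d k ∧ E d (L.move k x d) := by
  obtain ⟨b, c, hbc, hres⟩ : ∃ b c, E b c ∧ ¬ Δ.residueSetoid {k}ᶜ b c := by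
    by_contra! hEle
    exact hne (le_antisymm (fun b c => hEle b c) hle)
  obtain ⟨d, hbd, π, hπ, hcd⟩ :=
    (residueSetoid_or_exists_isWingColouring_ne (L := L) hM hΔ b c).resolve_left hres
  obtain ⟨⟨f, hf⟩, hfix, hmove⟩ := exists_smul_eq_and_smul_ne hp hr hcd
  obtain ⟨g, hgd, hg⟩ := hπ.exists_universalGroup_fix hM hΔ hf hfix
  have hdc : E d c := E.trans' (E.symm' (hle hbd)) hbc
  have hgdc : E (g • d) (g • c) := hE g hdc
  rw [hgd, hg c rfl] at hgdc
  exact ⟨d, f (L.col d k), hmove, E.trans' hdc (E.symm' hgdc)⟩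

theorem forall_rel_move_of_rel_move (hM : M.IsRightAngled) (hΔ : Δ.IsBuilding M)
    (hp : MulAction.IsPreprimitive (F k) (X k))
    (hE : ∀ g : L.universalGroup F, E ≤ E.comap (g • ·)) {d : C} {x : X k}
    (hx : x ≠ L.col d k) (hdx : E d (L.move k x d)) (y : X k) : E d (L.move k y d) := by
  have hinv : ∀ f : F k, E.comap (L.move k · d) ≤ (E.comap (L.move k · d)).comap (f • ·) := by
    rintro ⟨f, hf⟩ y z hyz
    obtain ⟨g, hgd, hg⟩ := L.exists_universalGroup_extend hM hΔ hf d
    have hmove : ∀ y, g • L.move k y d = L.move k (f y) d := fun y => by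
      refine (L.smul_eq_move_of_equiv g.1 (L.equiv_move k y d)).trans ?_
      refine (congrArg₂ (L.move k) (hg _) hgd).trans ?_
      rw [col_move_self, move_move]
    have hgyz : E (g • L.move k y d) (g • L.move k z d) := hE g hyz
    rwa [hmove, hmove] at hgyz
  rcases (isPreprimitive_iff_forall_setoid.1 hp).2 _ hinv with hbot | htop
  · have hcol : E.comap (L.move k · d) (L.col d k) x := by rwa [Setoid.comap_rel, move_col]
    rw [hbot] at hcol
    exact absurd hcol.symm hx
  · have hcol : E.comap (L.move k · d) (L.col d k) y := htop ▸ trivial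
    rwa [Setoid.comap_rel, move_col] at hcol

theorem equiv_le_of_forall_rel_move (hM : M.IsRightAngled) (hΔ : Δ.IsBuilding M)
    (ht : ∀ i, M i k = 0 → MulAction.IsPretransitive (F i) (X i))
    (hle : Δ.residueSetoid {k}ᶜ ≤ E) (hE : ∀ g : L.universalGroup F, E ≤ E.comap (g • ·)) {d : C}
    (hd : ∀ x, E d (L.move k x d)) : Δ.equiv k ≤ E := by
  have hmove := L.residueSetoid_le_iff.1 hle
  refine L.equiv_le_iff.2 fun x c => ?_
  induction c using L.induction_move hΔ d generalizing x with
  | base => exact hd x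
  | step i y c hc =>
    by_cases hi : i = k
    · subst hi
      simpa only [move_move] using E.trans' (E.symm' (hc y)) (hc x)
    · rcases hM i k hi with hik | hik
      · rw [← L.move_comm hM hΔ hik]
        exact E.trans' (E.symm' (hmove i hi y c)) (E.trans' (hc x) (hmove i hi y _))
      · obtain ⟨⟨f, hf⟩, hfy⟩ := (ht i hik).exists_smul_eq (L.col c i) y
        obtain ⟨g, hgc, -⟩ := L.exists_universalGroup_extend hM hΔ hf c
        have hgc : g.1 • c = L.move i y c := hgc.trans (congrArg (L.move i · c) hfy)
        obtain ⟨x, rfl⟩ := (L.localAction g.1 (Δ.residueAt {k} c)).surjective x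
        have hgx : E (g.1 • c) (g.1 • L.move k x c) := hE g (hc x)
        rwa [L.smul_move, hgc] at hgx

theorem isPreprimitive_residue (hM : M.IsRightAngled) (hΔ : Δ.IsBuilding M)
    (hp : MulAction.IsPreprimitive (F k) (X k)) (hr : ¬ IsRegularAction (F k) (X k))
    (ht : ∀ i, M i k = 0 → MulAction.IsPretransitive (F i) (X i)) :
    MulAction.IsPreprimitive (L.universalGroup F) (Δ.Residue {k}ᶜ) := by
  refine isPreprimitive_residue_iff.2 ⟨isPretransitive_residue hM hΔ hp.toIsPretransitive,
    fun E hle hE => or_iff_not_imp_left.2 fun hne => ?_⟩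
  obtain ⟨d, x, hx, hdx⟩ := exists_rel_move_of_ne_residueSetoid hM hΔ hp hr hle hE hne
  have hk : Δ.equiv k ≤ E := equiv_le_of_forall_rel_move hM hΔ ht hle hE
    (forall_rel_move_of_rel_move hM hΔ hp hE hx hdx)
  rw [eq_top_iff, ← hΔ.residueSetoid_univ, ChamberSystem.residueSetoid_le_iff]
  intro i _
  by_cases hi : i = k
  · exact hi ▸ hk
  · exact (equiv_le_residueSetoid hi).trans hle

end Sufficiency

end LegalColouring

end ChamberSystem

theorem mainTheorem3_general {I : Type*} {M : CoxeterMatrix I} (hM : M.IsRightAngled) {C : Type*}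
    {Δ : ChamberSystem I C} (hΔ : Δ.IsBuilding M) {X : I → Type*} (L : Δ.LegalColouring X)
    (F : ∀ i, Subgroup (Equiv.Perm (X i))) {J : Set I} (hJ : J ⊂ Set.univ)
    (hk : ∀ k : I, Jᶜ = {k} → ∃ i, M i k = 0) :
    MulAction.IsPreprimitive (L.universalGroup F) (Δ.Residue J) ↔
      ∃ k : I, Jᶜ = {k} ∧
        (MulAction.IsPreprimitive (F k) (X k) ∧ ¬ IsRegularAction (F k) (X k)) ∧
        ∀ i : I, M i k = 0 → MulAction.IsPretransitive (F i) (X i) := by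
  open ChamberSystem.LegalColouring in
  constructor
  · intro h
    obtain ⟨k, hJk⟩ := exists_compl_eq_singleton_of_isPreprimitive hΔ hJ h
    obtain ⟨i, hik⟩ := hk k hJk
    obtain rfl : J = {k}ᶜ := (compl_eq_comm.1 hJk).symm
    exact ⟨k, hJk, ⟨isPreprimitive_of_isPreprimitive_residue hM hΔ h,
      not_isRegularAction_of_isPreprimitive_residue hM hΔ hik h⟩,
      fun _ => isPretransitive_of_isPreprimitive_residue hM hΔ h⟩
  · rintro ⟨k, hJk, ⟨hp, hr⟩, ht⟩
    obtain rfl : J = {k}ᶜ := (compl_eq_comm.1 hJk).symm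
    exact isPreprimitive_residue hM hΔ hp hr ht

/-- The hypothesis `hk` says that, if `I ∖ J` is a single node `k`, then `k` is not an isolated
node of the Coxeter diagram. The entry `∞` of a Coxeter matrix is encoded as `0`. -/
theorem mainTheorem3 {I : Type*} [Finite I] (M : CoxeterMatrix I) (hM : M.IsRightAngled)
    {C : Type*} (Δ : ChamberSystem I C) (hΔ : Δ.IsBuilding M)
    {X : I → Type*} (hX : Δ.IsSemiregular X) (L : Δ.LegalColouring X)
    (F : ∀ i, Subgroup (Equiv.Perm (X i)))
    (J : Set I) (hJ : J ⊂ Set.univ)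
    (hk : ∀ k : I, Jᶜ = {k} → ∃ i, M i k = 0) :
    MulAction.IsPreprimitive (L.universalGroup F) (Δ.Residue J) ↔
      ∃ k : I, Jᶜ = {k} ∧
        (MulAction.IsPreprimitive (F k) (X k) ∧ ¬ IsRegularAction (F k) (X k)) ∧
        ∀ i : I, M i k = 0 → MulAction.IsPretransitive (F i) (X i) :=
  mainTheorem3_general hM hΔ L F hJ hk
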